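/- **Setting.** Let $D$ be a digraph with vertex set $V$ (loops and oppositely oriented edges are allowed; parallel edges play no role). A directed path is a sequence $x_0\dots x_n$ of vertices with $x_ix_{i+1}\in E(D)$ for $i<n$, its length is $n$, and $d(x,y)\in[0,\infty]$ is the length of a shortest directed path from $x$ to $y$ ($\infty$ if there is none); a geodesic is a directed path from $x$ to $y$ of length $d(x,y)$. Put $d^{\leftrightarrow}(x,y)=\min\{d(x,y),d(y,x)\}$, $\mathcal B^+_r(x)=\{y: d(x,y)\le r\}$ and $\mathcal B^-_r(x)=\{y: d(y,x)\le r\}$; the ball of radius $r$ around a path is the union of the balls of radius $r$ around its vertices. The out-degree (in-degree) of $x$ is the number of $y$ with $d(x,y)=1$ ($d(y,x)=1$). For $\delta\ge 0$, $D$ is *$\delta$-hyperbolic* if for all vertices $x,y,z$, every $x$-$y$ geodesic $P$, every geodesic $Q$ between $x$ and $z$ and every geodesic $R$ between $y$ and $z$ (the latter two directed either way), $P\subseteq \mathcal B^+_\delta(Q)\cup\mathcal B^-_\delta(R)$. $D$ satisfies (B1) (resp. (B2)) for $f\colon\mathbb R\to\mathbb R$ if for all $x\in V$, $r\ge0$ and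 all $y,z\in\mathcal B^+_r(x)$ (resp. $y,z\in\mathcal B^-_r(x)$) either $d(y,z)=\infty$ or $d(y,z)\le f(r)$. A set $S\subseteq V$ is a *base* if every $x\in V$ has some $s\in S$ with $d^{\leftrightarrow}(x,s)<\infty$. **Boundary.** A quasi-geodesic ray (anti-ray) is a sequence $R(0),R(1),\dots$ of distinct vertices with edges $R(i)R(i+1)$ (resp. $R(i+1)R(i)$) for which there are $\gamma\ge1$, $c\ge0$ such that each directed subpath, from $u$ to $v$ say, has length at most $\gamma d(u,v)+c$. For quasi-geodesic rays or anti-rays write $R_1\le R_2$ if there is $M$ such that for all $x\in V$ and $r\ge 0$ there is a directed path of length at most $M$ from a vertex of $R_1$ to a vertex of $R_2$ that avoids $\mathcal B^+_r(x)\cup\mathcal B^-_r(x)$; write $R_1\approx R_2$ if $R_1\le R_2$ and $R_2\le R_1$. The quasi-geodesic boundary $\partial D$ is the set of $\approx$-classes, and $D\cup\partial D$ means $V\cup\partial D$. **The pseudo-semimetric $d_{S,\varepsilon}$.** Let $S\subseteq V$ be a finite base and $\varepsilon>0$. A boundary point $\eta$ is represented by the sequences $(R(i))_i$ with $R\in\eta$,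 a vertex $x$ by the constant sequence $x$. For $s\in S$ and $\eta,\mu\in D\cup\partial D$ let $$\rho^\varepsilon_s(\eta,\mu)=\inf_{a,b}\exp\bigl(-\varepsilon\liminf\{d^{\leftrightarrow}(s,P) : i,j\to\infty,\ P\text{ an } a(i)\text{-}b(j)\text{ geodesic}\}\bigr),$$ where $a,b$ run through the sequences representing $\eta,\mu$, $d^{\leftrightarrow}(s,P)$ is the minimum of $d^{\leftrightarrow}(s,v)$ over the vertices $v$ of $P$, $\exp(-\infty)=0$, and the exponential term is replaced by $\infty$ if there are no $a(i)$-$b(j)$ geodesics with $i,j$ arbitrarily large. Let $\rho_S^\varepsilon=\max_{s\in S}\rho_s^\varepsilon$ and $$d_{S,\varepsilon}(\eta,\mu)=\inf\Bigl\{\sum_{i<n}\rho_S^\varepsilon(\eta_i,\eta_{i+1}) : n\ge 0,\ \eta=\eta_0,\eta_1,\dots,\eta_n=\mu\in D\cup\partial D\Bigr\}.$$ **Convergence.** For a set $X$ with $d\colon X\times X\to[0,\infty]$ satisfying $d(x,x)=0$ and the triangle inequality (a *pseudo-semimetric*; a *semimetric* if moreover $d(x,y)=0$ only for $x=y$), a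 sequence f-converges (b-converges) if it converges in the topology generated by the sets $\{y:d(x,y)<r\}$ (resp. $\{y:d(y,x)<r\}$), $x\in X$, $r\ge 0$. $X$ is *sequentially f-compact* if every sequence with $d(x_i,x_j)<\infty$ for all $i<j$ has a b-convergent subsequence, and *sequentially b-compact* if every sequence with $d(x_j,x_i)<\infty$ for all $i<j$ has an f-convergent subsequence. A sequence is f-Cauchy (b-Cauchy) if for every $\epsilon>0$ there is $N$ with $d(x_n,x_m)<\epsilon$ (resp. $d(x_m,x_n)<\epsilon$) for all $m\ge n\ge N$. $X$ is *f-complete* if every f-Cauchy sequence b-converges, and *b-complete* if every b-Cauchy sequence f-converges. **Theorem.** Let $\delta\ge0$ and let $D$ be a $\delta$-hyperbolic digraph that satisfies (B1) and (B2) for the function $f\colon\mathbb R\to\mathbb R$ and has a finite base $S$. Let $\varepsilon>0$ with $e^{2\varepsilon(6\delta+2\delta f(\delta+1))}<\sqrt2$. 1. If every vertex of $D$ has finite out-degree, then $(D\cup\partial D,d_{S,\varepsilon})$ is sequentially f-compact. 2. If every vertex of $D$ has finite in-degree, then $(D\cup\partial D,d_{S,\varepsilon})$ is sequentially b-compact.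 3. If every vertex of $D$ has finite out-degree and $d_{S,\varepsilon}$ is a semimetric on $D\cup\partial D$, then $D\cup\partial D$ is f-complete. 4. If every vertex of $D$ has finite in-degree and $d_{S,\varepsilon}$ is a semimetric on $D\cup\partial D$, then $D\cup\partial D$ is b-complete. -/

import Mathlib

open scoped ENNReal Topology

namespace HypDigraph

/-! ### Pseudo-semimetric spaces: a set `X` with a map `d : X → X → [0, ∞]` -/

section Semimetric

variable {X : Type*}

/-- `d` is a pseudo-semimetric. -/
structure IsPseudoSemimetric (d : X → X → ℝ≥0∞) : Prop where
  self : ∀ x, d x x = 0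
  triangle : ∀ x y z, d x y ≤ d x z + d z y

/-- `d` is a semimetric. -/
structure IsSemimetric (d : X → X → ℝ≥0∞) : Prop where
  eq_zero_iff : ∀ x y, d x y = 0 ↔ x = y
  triangle : ∀ x y z, d x y ≤ d x z + d z y

/-- `d^↔(x, y) = min {d(x, y), d(y, x)}`. -/
noncomputable def minDist (d : X → X → ℝ≥0∞) (x y : X) : ℝ≥0∞ := min (d x y) (d y x)

/-- The (closed) out-ball of radius `r ≥ 0` around `x`. -/
def outBall (d : X → X → ℝ≥0∞) (r : ℝ) (x : X) : Set X := {y | d x y ≤ ENNReal.ofReal r}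

/-- The (closed) in-ball of radius `r ≥ 0` around `x`. -/
def inBall (d : X → X → ℝ≥0∞) (r : ℝ) (x : X) : Set X := {y | d y x ≤ ENNReal.ofReal r}

/-- The out-ball of radius `r ≥ 0` around a set. -/
def outBallSet (d : X → X → ℝ≥0∞) (r : ℝ) (A : Set X) : Set X := ⋃ x ∈ A, outBall d r x

/-- The in-ball of radius `r ≥ 0` around a set. -/
def inBallSet (d : X → X → ℝ≥0∞) (r : ℝ) (A : Set X) : Set X := ⋃ x ∈ A, inBall d r x

/-- The open out-ball of radius `r ≥ 0` around `x`. -/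
def openOutBall (d : X → X → ℝ≥0∞) (r : ℝ) (x : X) : Set X := {y | d x y < ENNReal.ofReal r}

/-- The open in-ball of radius `r ≥ 0` around `x`. -/
def openInBall (d : X → X → ℝ≥0∞) (r : ℝ) (x : X) : Set X := {y | d y x < ENNReal.ofReal r}

/-- The forward topology, generated by the open out-balls. -/
abbrev forwardTopology (d : X → X → ℝ≥0∞) : TopologicalSpace X :=
  TopologicalSpace.generateFrom {U | ∃ (x : X) (r : ℝ), 0 ≤ r ∧ U = openOutBall d r x}

/-- The backward topology, generated by the open in-balls. -/
abbrev backwardTopology (d : X → X → ℝ≥0∞) : TopologicalSpace X :=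
  TopologicalSpace.generateFrom {U | ∃ (x : X) (r : ℝ), 0 ≤ r ∧ U = openInBall d r x}

/-- The sequence `u` f-converges to `x`. -/
def FConverges (d : X → X → ℝ≥0∞) (u : ℕ → X) (x : X) : Prop :=
  Filter.Tendsto u Filter.atTop (@nhds X (forwardTopology d) x)

/-- The sequence `u` b-converges to `x`. -/
def BConverges (d : X → X → ℝ≥0∞) (u : ℕ → X) (x : X) : Prop :=
  Filter.Tendsto u Filter.atTop (@nhds X (backwardTopology d) x)

/-- Forward Cauchy sequences. -/
def IsFCauchy (d : X → X → ℝ≥0∞) (u : ℕ → X) : Prop :=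
  ∀ ε : ℝ, 0 < ε → ∃ N : ℕ, ∀ n m, N ≤ n → n ≤ m → d (u n) (u m) < ENNReal.ofReal ε

/-- Backward Cauchy sequences. -/
def IsBCauchy (d : X → X → ℝ≥0∞) (u : ℕ → X) : Prop :=
  ∀ ε : ℝ, 0 < ε → ∃ N : ℕ, ∀ n m, N ≤ n → n ≤ m → d (u m) (u n) < ENNReal.ofReal ε

/-- f-complete: every f-Cauchy sequence b-converges. -/
def FComplete (d : X → X → ℝ≥0∞) : Prop :=
  ∀ u : ℕ → X, IsFCauchy d u → ∃ x, BConverges d u x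

/-- b-complete: every b-Cauchy sequence f-converges. -/
def BComplete (d : X → X → ℝ≥0∞) : Prop :=
  ∀ u : ℕ → X, IsBCauchy d u → ∃ x, FConverges d u x

/-- Sequentially f-compact. -/
def SeqFCompact (d : X → X → ℝ≥0∞) : Prop :=
  ∀ u : ℕ → X, (∀ i j, i < j → d (u i) (u j) < ⊤) →
    ∃ φ : ℕ → ℕ, StrictMono φ ∧ ∃ x, BConverges d (u ∘ φ) x

/-- Sequentially b-compact. -/
def SeqBCompact (d : X → X → ℝ≥0∞) : Prop :=
  ∀ u : ℕ → X, (∀ i j, i < j → d (u j) (u i) < ⊤) →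
    ∃ φ : ℕ → ℕ, StrictMono φ ∧ ∃ x, FConverges d (u ∘ φ) x

/-- Property (B1) for the function `f`: distances inside an out-ball of radius `r` are infinite
or at most `f r`. -/
def B1 (d : X → X → ℝ≥0∞) (f : ℝ → ℝ) : Prop :=
  ∀ (x : X) (r : ℝ), 0 ≤ r → ∀ y ∈ outBall d r x, ∀ z ∈ outBall d r x,
    d y z = ⊤ ∨ (d y z).toReal ≤ f r

/-- Property (B2) for the function `f`: distances inside an in-ball of radius `r` are infinite
or at most `f r`. -/
def B2 (d : X → X → ℝ≥0∞) (f : ℝ → ℝ) : Prop :=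
  ∀ (x : X) (r : ℝ), 0 ≤ r → ∀ y ∈ inBall d r x, ∀ z ∈ inBall d r x,
    d y z = ⊤ ∨ (d y z).toReal ≤ f r

/-- `S` is a base: every point has finite distance to or from some element of `S`. -/
def IsBase (d : X → X → ℝ≥0∞) (S : Set X) : Prop :=
  ∀ x, ∃ s ∈ S, minDist d x s < ⊤

end Semimetric

/-! ### Digraphs

Directed paths are sequences of vertices, so parallel edges play no role and a digraph is
given by its adjacency relation. A directed path of length `n` is given by the values
`p 0, …, p n` of a function `p : ℕ → V`. -/

section Digraph

variable {V : Type*} (D : Digraph V)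

/-- `p 0, …, p n` is a directed path of length `n` from `x` to `y`. -/
def IsDirPath (p : ℕ → V) (n : ℕ) (x y : V) : Prop :=
  p 0 = x ∧ p n = y ∧ ∀ i < n, D.Adj (p i) (p (i + 1))

/-- The vertices of the path `p 0, …, p n`. -/
def pathVerts (p : ℕ → V) (n : ℕ) : Set V := {v | ∃ i ≤ n, v = p i}

/-- The length of a shortest directed path from `x` to `y`, and `∞` if there is none. -/
noncomputable def dist (x y : V) : ℝ≥0∞ :=
  ⨅ (p : ℕ → V) (n : ℕ) (_ : IsDirPath D p n x y), (n : ℝ≥0∞)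

/-- `p 0, …, p n` is an `x`-`y` geodesic. -/
def IsGeodesic (p : ℕ → V) (n : ℕ) (x y : V) : Prop :=
  IsDirPath D p n x y ∧ (n : ℝ≥0∞) = dist D x y

/-- Every geodesic triangle is `δ`-thin. Here `p` is a side from `x` to `y`, and the two other
sides, `q` between `x` and the third point `z` and `r` between `y` and `z`, are directed in
either way. -/
def IsHyperbolic (δ : ℝ) : Prop :=
  ∀ (x y z : V) (p q r : ℕ → V) (l m n : ℕ),
    IsGeodesic D p l x y →
    (IsGeodesic D q m x z ∨ IsGeodesic D q m z x) →
    (IsGeodesic D r n y z ∨ IsGeodesic D r n z y) →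
    pathVerts p l ⊆
      outBallSet (dist D) δ (pathVerts q m) ∪ inBallSet (dist D) δ (pathVerts r n)

/-- Every vertex has finite out-degree. -/
def OutFinite : Prop := ∀ x : V, {y | dist D x y = 1}.Finite

/-- Every vertex has finite in-degree. -/
def InFinite : Prop := ∀ x : V, {y | dist D y x = 1}.Finite

/-- `R 0, R 1, …` is a ray all of whose finite directed subpaths are `(γ, c)`-quasi-geodesics,
for some `γ ≥ 1` and `c ≥ 0`. -/
def IsQuasiGeodRay (R : ℕ → V) : Prop :=
  Function.Injective R ∧ (∀ i, D.Adj (R i) (R (i + 1))) ∧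
    ∃ γ c : ℝ, 1 ≤ γ ∧ 0 ≤ c ∧ ∀ i j : ℕ, i ≤ j →
      ((j - i : ℕ) : ℝ≥0∞) ≤ ENNReal.ofReal γ * dist D (R i) (R j) + ENNReal.ofReal c

/-- `…, R 1, R 0` is an anti-ray all of whose finite directed subpaths are
`(γ, c)`-quasi-geodesics, for some `γ ≥ 1` and `c ≥ 0`. -/
def IsQuasiGeodAntiRay (R : ℕ → V) : Prop :=
  Function.Injective R ∧ (∀ i, D.Adj (R (i + 1)) (R i)) ∧
    ∃ γ c : ℝ, 1 ≤ γ ∧ 0 ≤ c ∧ ∀ i j : ℕ, i ≤ j →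
      ((j - i : ℕ) : ℝ≥0∞) ≤ ENNReal.ofReal γ * dist D (R j) (R i) + ENNReal.ofReal c

/-- The quasi-geodesic rays and anti-rays, as sequences of vertices. -/
def QGRay : Type _ := {R : ℕ → V // IsQuasiGeodRay D R ∨ IsQuasiGeodAntiRay D R}

variable {D}

/-- `R₁ ≤ R₂`: for some `M` there are directed `R₁`-`R₂` paths of length at most `M` outside of
every set `B⁺_r(x) ∪ B⁻_r(x)`. -/
def RayLE (R₁ R₂ : QGRay D) : Prop :=
  ∃ M : ℕ, ∀ (r : ℝ) (x : V), 0 ≤ r →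
    ∃ (i j : ℕ) (p : ℕ → V) (n : ℕ), n ≤ M ∧ IsDirPath D p n (R₁.1 i) (R₂.1 j) ∧
      ∀ v ∈ pathVerts p n, v ∉ outBall (dist D) r x ∪ inBall (dist D) r x

/-- `R₁ ≈ R₂`. -/
def RayEquiv (R₁ R₂ : QGRay D) : Prop := RayLE R₁ R₂ ∧ RayLE R₂ R₁

variable (D)

/-- The quasi-geodesic boundary `∂D`: its points are the equivalence classes of `≈`. -/
def Boundary : Type _ := {C : Set (QGRay D) // ∃ R : QGRay D, C = {Q | RayEquiv R Q}}

/-- `D ∪ ∂D`. -/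
abbrev Bordification : Type _ := V ⊕ Boundary D

variable {D}

/-- The vertex sequences that represent a point of `D ∪ ∂D`: the constant sequence for a vertex,
and the sequences `R 0, R 1, …` with `R ∈ η` for a boundary point `η`. -/
def reps : Bordification D → Set (ℕ → V)
  | Sum.inl x => {fun _ => x}
  | Sum.inr η => {a | ∃ R ∈ η.1, a = R.1}

variable (D)

/-- `d^↔(s, P)` for the path `P = p 0, …, p n`. -/
noncomputable def minDistPath (s : V) (p : ℕ → V) (n : ℕ) : ℝ≥0∞ :=
  ⨅ i ∈ Set.Iic n, minDist (dist D) s (p i)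

/-- `liminf {d^↔(s, P) | i, j → ∞, P is an a(i)-b(j) geodesic}`. If `a` or `b` is constant, then
there is no limit in this variable, and if both are, then this is an infimum. -/
noncomputable def geodLiminf (s : V) (a b : ℕ → V) : ℝ≥0∞ :=
  ⨆ N : ℕ, ⨅ (i : ℕ) (j : ℕ) (_ : N ≤ i) (_ : N ≤ j) (p : ℕ → V) (n : ℕ)
    (_ : IsGeodesic D p n (a i) (b j)), minDistPath D s p n

/-- There are `a(i)`-`b(j)` geodesics with `i` and `j` arbitrarily large. -/
def HasGeodesics (a b : ℕ → V) : Prop :=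
  ∀ N : ℕ, ∃ i j : ℕ, N ≤ i ∧ N ≤ j ∧ ∃ (p : ℕ → V) (n : ℕ), IsGeodesic D p n (a i) (b j)

open Classical in
/-- `exp (-ε · liminf {d^↔(s, P) | …})`, where `exp (-∞) = 0`; the value is `∞` if the liminf is
void, that is if there are no geodesics between late members of the two sequences. -/
noncomputable def geodExp (ε : ℝ) (s : V) (a b : ℕ → V) : ℝ≥0∞ :=
  if HasGeodesics D a b then
    EReal.exp (-((ENNReal.ofReal ε * geodLiminf D s a b : ℝ≥0∞) : EReal))
  else ⊤

variable {D}

/-- `ρ_s^ε` on `D ∪ ∂D`. -/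
noncomputable def rhoPt (ε : ℝ) (s : V) (η μ : Bordification D) : ℝ≥0∞ :=
  ⨅ a ∈ reps η, ⨅ b ∈ reps μ, geodExp D ε s a b

/-- `ρ_S^ε = max {ρ_s^ε | s ∈ S}` on `D ∪ ∂D`. -/
noncomputable def rho (S : Finset V) (ε : ℝ) (η μ : Bordification D) : ℝ≥0∞ :=
  S.sup fun s => rhoPt ε s η μ

variable (D)

/-- The pseudo-semimetric `d_{S,ε}` on `D ∪ ∂D`: the infimum of the sums of the values of `ρ_S^ε`
along the finite chains `η = η₀, η₁, …, ηₙ = μ` (a chain with `n = 0` is allowed if `η = μ`). -/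
noncomputable def bdDist (S : Finset V) (ε : ℝ) (η μ : Bordification D) : ℝ≥0∞ :=
  ⨅ (n : ℕ) (c : ℕ → Bordification D) (_ : c 0 = η) (_ : c n = μ),
    ∑ i ∈ Finset.range n, rho S ε (c i) (c (i + 1))

theorem bdDist_isPseudoSemimetric (S : Finset V) (ε : ℝ) :
    IsPseudoSemimetric (bdDist D S ε) where
  self x := by
    refine le_antisymm ?_ zero_le
    refine (iInf_le _ 0).trans ((iInf_le _ (fun _ => x)).trans ?_)
    simp
  triangle x y z := by
    rw [add_comm]
    unfold bdDist
    simp only [ENNReal.iInf_add, ENNReal.add_iInf]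
    refine le_iInf fun n => le_iInf fun c => le_iInf fun h0 => le_iInf fun hn => ?_
    refine le_iInf fun m => le_iInf fun e => le_iInf fun g0 => le_iInf fun hm => ?_
    rw [add_comm]
    refine (iInf_le _ (n + m)).trans
      ((iInf_le _ (fun i => if i ≤ n then c i else e (i - n))).trans ?_)
    refine (iInf_le _ (by simp [h0])).trans ((iInf_le _ ?_).trans ?_)
    · rcases Nat.eq_zero_or_pos m with rfl | h
      · simp [hn, ← hm, g0]
      · simp [show ¬ (n + m ≤ n) by omega, hm]
    · rw [Finset.sum_range_add]
      refine add_le_add (Finset.sum_le_sum fun i hi => ?_) (Finset.sum_le_sum fun i hi => ?_)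
      · rw [Finset.mem_range] at hi
        simp [hi.le, Nat.succ_le_of_lt hi]
      · have : (if n + i ≤ n then c (n + i) else e (n + i - n)) = e i := by
          rcases Nat.eq_zero_or_pos i with rfl | h
          · simp [hn, g0]
          · simp [show ¬ (n + i ≤ n) by omega]
        simp only [this]
        simp [show ¬ (n + i + 1 ≤ n) by omega, show n + i + 1 - n = i + 1 by omega]

end Digraph

end HypDigraph

/-! Completeness follows from compactness: a tail of an f-Cauchy sequence has finite forward
distances, and the triangle inequality passes the b-limit of a subsequence on to the whole sequence.
Reversing all edges swaps the arguments of the boundary distance, so the in-degree statements follow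
from the out-degree ones. What remains is `exists_subseq_tendsto_bdDist`.

Represent each `u k` by a vertex sequence `a k`. Finite distance from `u i` to `u j` means that late
vertices of `a j` can be reached from late vertices of `a i` (`LateReach`). Suppose no point recurs
infinitely often.

If, for infinitely many `k`, all late vertices of `a k` reach late vertices of `a (k + 1)`, then
some vertex `o` reaches all the remaining sequences. Finite out-degree yields a geodesic ray `R` as
a limit of geodesics from `o` (König's lemma). Thin triangles together with (B1) and (B2) give paths
from late vertices of `a k` to `R` (`Hyp.reach_of_agree`) and push the geodesics between them away
from `o` (`Hyp.not_dle_of_agree`), so a subsequence converges to the class of `R`.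

Otherwise consecutive points are eventually anti-rays with no vertex between them. Reachability is
then symmetric and the connecting geodesics are far from every vertex, so backward distances vanish
and a fixed member of the sequence is the limit.

The input on quasi-geodesics is `QRay.exists_dle`: geodesics between ray vertices stay within a
distance of the ray that is only logarithmic in the index, whereas the distance from the start of
the ray grows linearly in it. -/

namespace HypDigraph

/-! ### Bounded reachability and geodesics in terms of natural numbers -/

section Basic

variable {V : Type*} {D : Digraph V}

/-- The digraph with all edges reversed. -/
def rev (D : Digraph V) : Digraph V := ⟨fun x y => D.Adj y x⟩

/-- There is a directed path of length at most `n` from `x` to `y`. -/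
def Dle (D : Digraph V) (x y : V) (n : ℕ) : Prop :=
  ∃ (p : ℕ → V) (m : ℕ), m ≤ n ∧ IsDirPath D p m x y

/-- There is a directed path from `x` to `y`. -/
def Reach (D : Digraph V) (x y : V) : Prop := ∃ n, Dle D x y n

theorem Dle.mono {x y : V} {n m : ℕ} (h : Dle D x y n) (hnm : n ≤ m) : Dle D x y m := by
  obtain ⟨p, k, hk, hp⟩ := h
  exact ⟨p, k, hk.trans hnm, hp⟩

theorem Dle.reach {x y : V} {n : ℕ} (h : Dle D x y n) : Reach D x y := ⟨n, h⟩

theorem Dle.refl (x : V) (n : ℕ) : Dle D x x n :=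
  ⟨fun _ => x, 0, n.zero_le, rfl, rfl, fun i hi => absurd hi (Nat.not_lt_zero i)⟩

theorem Dle.of_adj {x y : V} (h : D.Adj x y) : Dle D x y 1 :=
  ⟨fun i => if i = 0 then x else y, 1, le_rfl, by simp, by simp, fun i hi => by
    obtain rfl : i = 0 := by omega
    simpa using h⟩

theorem IsDirPath.concat {p q : ℕ → V} {n m : ℕ} {x y z : V} (hp : IsDirPath D p n x y)
    (hq : IsDirPath D q m y z) :
    IsDirPath D (fun i => if i ≤ n then p i else q (i - n)) (n + m) x z := by
  obtain ⟨p0, pn, hp⟩ := hp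
  obtain ⟨q0, qm, hq⟩ := hq
  refine ⟨by simp [p0], ?_, fun i hi => ?_⟩
  · rcases Nat.eq_zero_or_pos m with rfl | h
    · simp [pn, ← q0, qm]
    · simp [show ¬ n + m ≤ n by omega, qm]
  · dsimp only
    rcases lt_trichotomy i n with h | rfl | h
    · rw [if_pos h.le, if_pos (by omega : i + 1 ≤ n)]
      exact hp i h
    · rw [if_pos le_rfl, if_neg (by omega : ¬ i + 1 ≤ i), pn, ← q0, Nat.add_sub_cancel_left]
      exact hq 0 (by omega)
    · rw [if_neg (by omega), if_neg (by omega), show i + 1 - n = i - n + 1 by omega]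
      exact hq (i - n) (by omega)

theorem Dle.trans {x y z : V} {n m : ℕ} (h : Dle D x y n) (h' : Dle D y z m) :
    Dle D x z (n + m) := by
  obtain ⟨p, k, hk, hp⟩ := h
  obtain ⟨q, l, hl, hq⟩ := h'
  exact ⟨_, k + l, by omega, hp.concat hq⟩

theorem Reach.refl (x : V) : Reach D x x := ⟨0, Dle.refl x 0⟩

theorem Reach.trans {x y z : V} (h : Reach D x y) (h' : Reach D y z) : Reach D x z := by
  obtain ⟨n, h⟩ := h
  obtain ⟨m, h'⟩ := h'
  exact ⟨_, h.trans h'⟩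

theorem IsDirPath.rev {p : ℕ → V} {n : ℕ} {x y : V} (hp : IsDirPath D p n x y) :
    IsDirPath (rev D) (fun i => p (n - i)) n y x := by
  obtain ⟨p0, pn, hp⟩ := hp
  refine ⟨by simpa using pn, by simpa using p0, fun i hi => ?_⟩
  have := hp (n - (i + 1)) (by omega)
  rwa [show n - (i + 1) + 1 = n - i by omega] at this

theorem Dle.rev {x y : V} {n : ℕ} (h : Dle D x y n) : Dle (rev D) y x n := by
  obtain ⟨p, k, hk, hp⟩ := h
  exact ⟨_, k, hk, hp.rev⟩

theorem dle_rev {x y : V} {n : ℕ} : Dle (rev D) x y n ↔ Dle D y x n :=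
  ⟨fun h => h.rev, fun h => h.rev⟩

theorem reach_rev {x y : V} : Reach (rev D) x y ↔ Reach D y x := by
  simp [Reach, dle_rev]

theorem dle_iff_dist_le {x y : V} {n : ℕ} : Dle D x y n ↔ dist D x y ≤ n := by
  constructor
  · rintro ⟨p, m, hm, hp⟩
    exact iInf_le_of_le p (iInf_le_of_le m (iInf_le_of_le hp (by exact_mod_cast hm)))
  · intro h
    have h' : dist D x y < ((n + 1 : ℕ) : ℝ≥0∞) :=
      h.trans_lt (by exact_mod_cast Nat.lt_succ_self n)
    simp only [dist, iInf_lt_iff] at h'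
    obtain ⟨p, m, hp, hm⟩ := h'
    exact ⟨p, m, Nat.lt_succ_iff.1 (by exact_mod_cast hm), hp⟩

theorem reach_iff_dist_ne_top {x y : V} : Reach D x y ↔ dist D x y ≠ ⊤ := by
  constructor
  · rintro ⟨n, h⟩
    exact ne_top_of_le_ne_top (ENNReal.natCast_ne_top n) (dle_iff_dist_le.1 h)
  · intro h
    have h' := lt_top_iff_ne_top.2 h
    simp only [dist, iInf_lt_iff] at h'
    obtain ⟨p, m, hp, -⟩ := h'
    exact ⟨m, p, m, le_rfl, hp⟩

theorem dist_rev (x y : V) : dist (rev D) x y = dist D y x := by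
  refine le_antisymm ?_ ?_
  · refine le_iInf fun p => le_iInf fun n => le_iInf fun hp => ?_
    exact dle_iff_dist_le.1 (dle_rev.2 ⟨p, n, le_rfl, hp⟩)
  · refine le_iInf fun p => le_iInf fun n => le_iInf fun hp => ?_
    exact dle_iff_dist_le.1 (dle_rev.1 ⟨p, n, le_rfl, hp⟩)

theorem dle_of_dist_le {x y : V} {r : ℝ} (h : dist D x y ≤ ENNReal.ofReal r) :
    Dle D x y ⌈r⌉₊ := by
  rw [dle_iff_dist_le]
  refine h.trans ?_
  rw [← ENNReal.ofReal_natCast]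
  exact ENNReal.ofReal_le_ofReal (Nat.le_ceil r)

/-- `p 0, …, p n` is a shortest directed path from `x` to `y`. -/
structure Geo (D : Digraph V) (p : ℕ → V) (n : ℕ) (x y : V) : Prop where
  path : IsDirPath D p n x y
  min : ∀ m, Dle D x y m → n ≤ m

theorem isGeodesic_iff {p : ℕ → V} {n : ℕ} {x y : V} :
    IsGeodesic D p n x y ↔ Geo D p n x y := by
  constructor
  · rintro ⟨hp, h⟩
    refine ⟨hp, fun m hm => ?_⟩
    rw [dle_iff_dist_le, ← h] at hm
    exact_mod_cast hm
  · rintro ⟨hp, h⟩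
    refine ⟨hp, le_antisymm ?_ (dle_iff_dist_le.1 ⟨p, n, le_rfl, hp⟩)⟩
    refine le_iInf fun q => le_iInf fun m => le_iInf fun hq => ?_
    exact_mod_cast h m ⟨q, m, le_rfl, hq⟩

theorem Reach.exists_geo {x y : V} (h : Reach D x y) : ∃ p n, Geo D p n x y := by
  classical
  have h' : ∃ n, Dle D x y n := h
  obtain ⟨p, m, hm, hp⟩ := Nat.find_spec h'
  have key : ∀ k, Dle D x y k → Nat.find h' ≤ k := fun k hk => Nat.find_min' h' hk
  exact ⟨p, m, hp, fun k hk => hm.trans (key k hk)⟩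

theorem Dle.exists_geo {x y : V} {n : ℕ} (h : Dle D x y n) : ∃ p m, m ≤ n ∧ Geo D p m x y := by
  obtain ⟨p, m, hp⟩ := h.reach.exists_geo
  exact ⟨p, m, hp.min _ h, hp⟩

variable {p : ℕ → V} {n : ℕ} {x y : V}

theorem IsDirPath.dle_apply (hp : IsDirPath D p n x y) {i j : ℕ} (hij : i ≤ j) (hj : j ≤ n) :
    Dle D (p i) (p j) (j - i) := by
  induction j, hij using Nat.le_induction with
  | base => exact Dle.refl _ _
  | succ k hik ih =>
    exact ((ih (by omega)).trans (Dle.of_adj (hp.2.2 k (by omega)))).mono (by omega)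

theorem Geo.zero (hp : Geo D p n x y) : p 0 = x := hp.path.1

theorem Geo.last (hp : Geo D p n x y) : p n = y := hp.path.2.1

theorem Geo.dle (hp : Geo D p n x y) : Dle D x y n := ⟨p, n, le_rfl, hp.path⟩

theorem Geo.dle_apply (hp : Geo D p n x y) {i j : ℕ} (hij : i ≤ j) (hj : j ≤ n) :
    Dle D (p i) (p j) (j - i) := hp.path.dle_apply hij hj

theorem Geo.dle_left (hp : Geo D p n x y) {i : ℕ} (hi : i ≤ n) : Dle D x (p i) i := by
  simpa [hp.zero] using hp.dle_apply (Nat.zero_le i) hi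

theorem Geo.dle_right (hp : Geo D p n x y) {i : ℕ} (hi : i ≤ n) : Dle D (p i) y (n - i) := by
  simpa [hp.last] using hp.dle_apply hi le_rfl

theorem Geo.le_of_dle (hp : Geo D p n x y) {i j m : ℕ} (hi : i ≤ n) (hj : j ≤ n)
    (h : Dle D (p i) (p j) m) : j ≤ i + m := by
  have := hp.min _ (((hp.dle_left hi).trans h).trans (hp.dle_right hj))
  omega

theorem Geo.le_of_dle_left (hp : Geo D p n x y) {j m : ℕ} (hj : j ≤ n)
    (h : Dle D x (p j) m) : j ≤ m := by
  have := hp.le_of_dle (Nat.zero_le n) hj (by rwa [hp.zero])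
  omega

theorem Geo.le_of_dle_right (hp : Geo D p n x y) {i m : ℕ} (hi : i ≤ n)
    (h : Dle D (p i) y m) : n ≤ i + m :=
  hp.le_of_dle hi le_rfl (by rwa [hp.last])

/-- The part of a geodesic between two of its vertices. -/
theorem Geo.sub (hp : Geo D p n x y) {i j : ℕ} (hij : i ≤ j) (hj : j ≤ n) :
    Geo D (fun k => p (i + k)) (j - i) (p i) (p j) where
  path := ⟨rfl, by simp [Nat.add_sub_cancel' hij], fun k hk => hp.path.2.2 (i + k) (by omega)⟩
  min m hm := by
    have := hp.le_of_dle (hij.trans hj) hj hm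
    omega

theorem Geo.take (hp : Geo D p n x y) {j : ℕ} (hj : j ≤ n) : Geo D p j x (p j) := by
  have := hp.sub (Nat.zero_le j) hj
  simpa [hp.zero] using this

theorem Geo.drop (hp : Geo D p n x y) {i : ℕ} (hi : i ≤ n) :
    Geo D (fun k => p (i + k)) (n - i) (p i) y := by
  have := hp.sub hi le_rfl
  rwa [hp.last] at this

theorem Geo.rev (hp : Geo D p n x y) : Geo (rev D) (fun i => p (n - i)) n y x :=
  ⟨hp.path.rev, fun m hm => hp.min m (dle_rev.1 hm)⟩

end Basic

/-! ### Hyperbolic digraphs with integral constants -/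

section Hyp

variable {V : Type*} {D : Digraph V} {Δ : ℕ} {g : ℕ → ℕ}

/-- A digraph whose geodesic triangles are `Δ`-thin and which satisfies (B1) and (B2) for the
monotone function `g`, where all the constants are natural numbers. -/
structure Hyp (D : Digraph V) (Δ : ℕ) (g : ℕ → ℕ) : Prop where
  thin : ∀ {x y z : V} {p q r : ℕ → V} {l m n : ℕ}, Geo D p l x y →
    (Geo D q m x z ∨ Geo D q m z x) → (Geo D r n y z ∨ Geo D r n z y) → ∀ i ≤ l,
      (∃ j ≤ m, Dle D (q j) (p i) Δ) ∨ (∃ j ≤ n, Dle D (p i) (r j) Δ)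
  b1 : ∀ {x y z : V} {r : ℕ}, Dle D x y r → Dle D x z r → Reach D y z → Dle D y z (g r)
  b2 : ∀ {x y z : V} {r : ℕ}, Dle D y x r → Dle D z x r → Reach D y z → Dle D y z (g r)
  mono : Monotone g

/-- Reversal swaps the ends of the first side and exchanges out-balls with in-balls, so thinness is
self-dual; (B1) and (B2) are exchanged. -/
theorem Hyp.rev (h : Hyp D Δ g) : Hyp (rev D) Δ g where
  thin {x y z p q r l m n} hp hq hr i hi := by
    have hp' := hp.rev
    have hr' : Geo D (fun i => r (n - i)) n y z ∨ Geo D (fun i => r (n - i)) n z y :=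
      hr.symm.imp Geo.rev Geo.rev
    have hq' : Geo D (fun i => q (m - i)) m x z ∨ Geo D (fun i => q (m - i)) m z x :=
      hq.symm.imp Geo.rev Geo.rev
    have := h.thin hp' hr' hq' (l - i) (by omega)
    rw [show l - (l - i) = i by omega] at this
    rcases this with ⟨j, hj, hd⟩ | ⟨j, hj, hd⟩
    · exact Or.inr ⟨n - j, by omega, hd.rev⟩
    · exact Or.inl ⟨m - j, by omega, hd.rev⟩
  b1 h1 h2 h3 := (h.b2 (dle_rev.1 h2) (dle_rev.1 h1) (reach_rev.1 h3)).rev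
  b2 h1 h2 h3 := (h.b1 (dle_rev.1 h2) (dle_rev.1 h1) (reach_rev.1 h3)).rev
  mono := h.mono

theorem Hyp.b1' (h : Hyp D Δ g) {x y z : V} {r s : ℕ} (h1 : Dle D x y r) (h2 : Dle D x z s)
    (h3 : Reach D y z) : Dle D y z (g (max r s)) :=
  h.b1 (h1.mono (le_max_left _ _)) (h2.mono (le_max_right _ _)) h3

theorem Hyp.b2' (h : Hyp D Δ g) {x y z : V} {r s : ℕ} (h1 : Dle D y x r) (h2 : Dle D z x s)
    (h3 : Reach D y z) : Dle D y z (g (max r s)) :=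
  h.b2 (h1.mono (le_max_left _ _)) (h2.mono (le_max_right _ _)) h3

theorem IsHyperbolic.exists_hyp {δ : ℝ} (hD : IsHyperbolic D δ) {f : ℝ → ℝ}
    (h1 : B1 (dist D) f) (h2 : B2 (dist D) f) : ∃ Δ g, Hyp D Δ g := by
  have hle : ∀ r : ℕ, ⌈f r⌉₊ ≤ (Finset.range (r + 1)).sup fun k : ℕ => ⌈f k⌉₊ := fun r =>
    Finset.le_sup (f := fun k : ℕ => ⌈f k⌉₊) (Finset.self_mem_range_succ r)
  have key : ∀ {y z : V} {r : ℕ}, Reach D y z → dist D y z = ⊤ ∨ (dist D y z).toReal ≤ f r →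
      Dle D y z ((Finset.range (r + 1)).sup fun k : ℕ => ⌈f k⌉₊) := by
    intro y z r hr h
    have hne := reach_iff_dist_ne_top.1 hr
    have h' := h.resolve_left hne
    refine Dle.mono (dle_of_dist_le (r := f r) ?_) (hle r)
    exact (ENNReal.le_ofReal_iff_toReal_le hne (ENNReal.toReal_nonneg.trans h')).2 h'
  -- The running maximum makes the bound monotone although `f` need not be.
  refine ⟨⌈δ⌉₊, fun r => (Finset.range (r + 1)).sup fun k : ℕ => ⌈f k⌉₊, ?_, ?_, ?_, ?_⟩
  · intro x y z p q r l m n hp hq hr i hi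
    have := hD x y z p q r l m n (isGeodesic_iff.2 hp) (hq.imp isGeodesic_iff.2 isGeodesic_iff.2)
      (hr.imp isGeodesic_iff.2 isGeodesic_iff.2) ⟨i, hi, rfl⟩
    simp only [outBallSet, inBallSet, outBall, inBall, pathVerts, Set.mem_union, Set.mem_iUnion,
      Set.mem_ofPred_eq, exists_prop] at this
    rcases this with ⟨_, ⟨j, hj, rfl⟩, hd⟩ | ⟨_, ⟨j, hj, rfl⟩, hd⟩
    · exact Or.inl ⟨j, hj, dle_of_dist_le hd⟩
    · exact Or.inr ⟨j, hj, dle_of_dist_le hd⟩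
  · intro x y z r hy hz hr
    rw [dle_iff_dist_le] at hy hz
    exact key hr (h1 x r r.cast_nonneg y (by simpa [outBall] using hy) z
      (by simpa [outBall] using hz))
  · intro x y z r hy hz hr
    rw [dle_iff_dist_le] at hy hz
    exact key hr (h2 x r r.cast_nonneg y (by simpa [inBall] using hy) z
      (by simpa [inBall] using hz))
  · intro a b hab
    exact Finset.sup_mono (Finset.range_mono (by omega))

/-- The sides of a triangle with directed two-sided base are close in forward direction. -/
theorem Hyp.thin_forward (h : Hyp D Δ g) {x y z : V} {p q r : ℕ → V} {l m n : ℕ}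
    (hp : Geo D p l x y) (hq : Geo D q m x z) (hr : Geo D r n z y) {i : ℕ} (hi : i ≤ l) :
    (∃ j ≤ m, Dle D (p i) (q j) (g (Δ + 1) + 4 * Δ + 2)) ∨
      (∃ j ≤ n, Dle D (p i) (r j) (g (Δ + 1) + 4 * Δ + 2)) := by
  classical
  -- Take the first vertex of `q` that is near `r`, or is reached from the part of `p` after `p i`.
  -- Its predecessor must then be reached from the part of `p` before `p i`.
  have hex : ∃ k, k ≤ m ∧ ((∃ i' ≤ l, i ≤ i' ∧ Dle D (p i') (q k) Δ) ∨
      ∃ j ≤ n, Dle D (q k) (r j) Δ) :=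
    ⟨m, le_rfl, Or.inr ⟨0, Nat.zero_le n, by rw [hq.last, hr.zero]; exact Dle.refl _ _⟩⟩
  obtain ⟨hkm, hk⟩ := Nat.find_spec hex
  have hmin : ∀ k, k < Nat.find hex → ¬ _ := fun k hk => Nat.find_min hex hk
  generalize Nat.find hex = k at hkm hk hmin
  have hi0 : ∃ i0 ≤ i, Dle D (p i0) (q k) (Δ + 1) := by
    rcases Nat.eq_zero_or_pos k with rfl | hk0
    · exact ⟨0, Nat.zero_le i, by rw [hp.zero, hq.zero]; exact Dle.refl _ _⟩
    · have hq1 : Dle D (q (k - 1)) (q k) 1 := (hq.dle_apply (by omega) hkm).mono (by omega)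
      have hn := hmin (k - 1) (by omega)
      rcases h.thin hq (Or.inl hp) (Or.inl hr) (k - 1) (by omega) with ⟨j, hj, hd⟩ | ⟨j, hj, hd⟩
      · by_cases hij : i ≤ j
        · exact absurd ⟨by omega, Or.inl ⟨j, hj, hij, hd⟩⟩ hn
        · exact ⟨j, by omega, hd.trans hq1⟩
      · exact absurd ⟨by omega, Or.inr ⟨j, hj, hd⟩⟩ hn
  obtain ⟨i0, hi0, hd0⟩ := hi0
  rcases hk with ⟨i', hi', hii', hd⟩ | ⟨j, hj, hd⟩
  · have h1 := h.b2 hd0 (hd.mono (Nat.le_succ _)) (hp.dle_apply (hi0.trans hii') hi').reach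
    have h3 := hp.le_of_dle (by omega) hi' h1
    exact Or.inl ⟨k, hkm, ((hp.dle_apply hii' hi').trans hd).mono (by omega)⟩
  · have hd1 := hd0.trans hd
    obtain ⟨s, e, he, hs⟩ := hd1.exists_geo
    -- The short geodesic `s` has length at most `2Δ + 1`, so its `Δ`-neighbourhood contains no `p
    -- i1` with `i1` beyond `i0 + 3Δ + 1`.
    have key : ∀ i1, i0 ≤ i1 → i1 ≤ l → (∃ j ≤ n, Dle D (p i1) (r j) Δ) ∨
        i1 ≤ i0 + (3 * Δ + 1) := by
      intro i1 h01 h1l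
      rcases h.thin (hp.drop (by omega : i0 ≤ l)) (Or.inl hs) (Or.inr (hr.drop hj)) (i1 - i0)
        (by omega) with ⟨b, hb, hdb⟩ | ⟨b, hb, hdb⟩
      · rw [Nat.add_sub_cancel' h01] at hdb
        exact Or.inr (by
          have := hp.le_of_dle (by omega) h1l ((hs.dle_left hb).trans hdb)
          omega)
      · rw [Nat.add_sub_cancel' h01] at hdb
        exact Or.inl ⟨j + b, by omega, hdb⟩
    by_cases hil : i0 + (3 * Δ + 2) ≤ l
    · by_cases hii : i ≤ i0 + (3 * Δ + 2)
      · rcases key (i0 + (3 * Δ + 2)) (by omega) hil with ⟨b, hb, hdb⟩ | hb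
        · exact Or.inr ⟨b, hb, ((hp.dle_apply hii hil).trans hdb).mono (by omega)⟩
        · omega
      · rcases key i hi0 hi with ⟨b, hb, hdb⟩ | hb
        · exact Or.inr ⟨b, hb, hdb.mono (by omega)⟩
        · omega
    · refine Or.inr ⟨n, le_rfl, ?_⟩
      rw [hr.last]
      exact (hp.dle_right hi).mono (by omega)

end Hyp

/-! ### Quasi-geodesic rays -/

section Ray

variable {V : Type*} {D : Digraph V} {Δ : ℕ} {g : ℕ → ℕ}

/-- `a 0, a 1, …` is a ray whose directed subpaths from `u` to `v` have length at most
`c * d(u, v) + c`. -/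
structure QRay (D : Digraph V) (a : ℕ → V) (c : ℕ) : Prop where
  adj : ∀ i, D.Adj (a i) (a (i + 1))
  quasi : ∀ {i j m : ℕ}, i ≤ j → Dle D (a i) (a j) m → j ≤ i + c * m + c

theorem dle_of_adj {a : ℕ → V} (ha : ∀ i, D.Adj (a i) (a (i + 1))) {i j : ℕ} (hij : i ≤ j) :
    Dle D (a i) (a j) (j - i) := by
  induction j, hij using Nat.le_induction with
  | base => exact Dle.refl _ _
  | succ k hik ih => exact (ih.trans (Dle.of_adj (ha k))).mono (by omega)

theorem QRay.dle {a : ℕ → V} {c : ℕ} (ha : QRay D a c) {i j : ℕ} (hij : i ≤ j) :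
    Dle D (a i) (a j) (j - i) := dle_of_adj ha.adj hij

theorem QRay.reach {a : ℕ → V} {c : ℕ} (ha : QRay D a c) {i j : ℕ} (hij : i ≤ j) :
    Reach D (a i) (a j) := (ha.dle hij).reach

theorem isQuasiGeodRay_rev {a : ℕ → V} :
    IsQuasiGeodRay (rev D) a ↔ IsQuasiGeodAntiRay D a := by
  simp only [IsQuasiGeodRay, IsQuasiGeodAntiRay, dist_rev]
  rfl

theorem isQuasiGeodAntiRay_rev {a : ℕ → V} :
    IsQuasiGeodAntiRay (rev D) a ↔ IsQuasiGeodRay D a := by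
  simp only [IsQuasiGeodRay, IsQuasiGeodAntiRay, dist_rev]
  rfl

theorem IsQuasiGeodRay.exists_qRay {a : ℕ → V} (ha : IsQuasiGeodRay D a) :
    ∃ c, QRay D a c := by
  obtain ⟨-, hadj, γ, c, -, hc, h⟩ := ha
  refine ⟨max ⌈γ⌉₊ ⌈c⌉₊, hadj, fun {i j m} hij hd => ?_⟩
  have h1 : ∀ x : ℝ, ENNReal.ofReal x ≤ (⌈x⌉₊ : ℝ≥0∞) := fun x => by
    rw [← ENNReal.ofReal_natCast]
    exact ENNReal.ofReal_le_ofReal (Nat.le_ceil x)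
  have h2 : ((j - i : ℕ) : ℝ≥0∞) ≤ ((⌈γ⌉₊ * m + ⌈c⌉₊ : ℕ) : ℝ≥0∞) := by
    refine (h i j hij).trans ?_
    push_cast
    exact add_le_add (mul_le_mul' (h1 γ) (dle_iff_dist_le.1 hd)) (h1 c)
  have h3 : j - i ≤ ⌈γ⌉₊ * m + ⌈c⌉₊ := by exact_mod_cast h2
  have h4 : ⌈γ⌉₊ * m ≤ max ⌈γ⌉₊ ⌈c⌉₊ * m := Nat.mul_le_mul_right _ (le_max_left _ _)
  have h5 := le_max_right ⌈γ⌉₊ ⌈c⌉₊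
  omega

/-- A quasi-geodesic ray leaves the balls around every vertex. -/
theorem QRay.leaves (h : Hyp D Δ g) {a : ℕ → V} {c : ℕ} (ha : QRay D a c) (x : V) (r : ℕ) :
    ∃ N, ∀ i, N ≤ i → ¬ Dle D x (a i) r ∧ ¬ Dle D (a i) x r := by
  -- Ray vertices in one ball have forward distance at most `g r`, which bounds the difference of
  -- their indices.
  have aux : ∀ P : ℕ → Prop, (∀ i j, i ≤ j → P i → P j → Dle D (a i) (a j) (g r)) →
      ∃ N, ∀ i, N ≤ i → ¬ P i := by
    intro P hP
    by_cases hex : ∃ i, P i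
    · obtain ⟨i, hi⟩ := hex
      refine ⟨i + c * g r + c + 1, fun j hj hPj => ?_⟩
      have hij : i ≤ j := by omega
      have := ha.quasi hij (hP i j hij hi hPj)
      omega
    · exact ⟨0, fun i _ hi => hex ⟨i, hi⟩⟩
  obtain ⟨N1, h1⟩ := aux (fun i => Dle D x (a i) r)
    fun i j hij hi hj => h.b1 hi hj (ha.reach hij)
  obtain ⟨N2, h2⟩ := aux (fun i => Dle D (a i) x r)
    fun i j hij hi hj => h.b2 hi hj (ha.reach hij)
  exact ⟨max N1 N2, fun i hi => ⟨h1 i (le_of_max_le_left hi), h2 i (le_of_max_le_right hi)⟩⟩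

/-- Vertices of a geodesic are logarithmically close to every path between its ends. -/
theorem Hyp.exists_dle_of_le_two_pow (h : Hyp D Δ g) {κ : ℕ} (hκ : κ = g (Δ + 1) + 4 * Δ + 2)
    {a : ℕ → V} (ha : ∀ i, D.Adj (a i) (a (i + 1))) (L : ℕ) :
    ∀ {n n' l : ℕ} {p : ℕ → V}, n ≤ n' → n' ≤ n + 2 ^ L → Geo D p l (a n) (a n') →
      ∀ k ≤ l, ∃ i, n ≤ i ∧ i ≤ n' ∧ Dle D (p k) (a i) (κ * L + 1) := by
  induction L with
  | zero =>
    intro n n' l p hn hn' hp k hk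
    refine ⟨n', hn, le_rfl, (hp.dle_right hk).mono ?_⟩
    have := hp.min _ (dle_of_adj ha hn)
    simp at hn'
    omega
  | succ L ih =>
    intro n n' l p hn hn' hp k hk
    rw [pow_succ] at hn'
    have h1 : n ≤ n + (n' - n) / 2 := by omega
    have h2 : n + (n' - n) / 2 ≤ n' := by omega
    -- Bisection: each of the `L` halvings costs one application of `thin_forward`, that is `κ`.
    obtain ⟨q, m, hq⟩ := (dle_of_adj ha h1).reach.exists_geo
    obtain ⟨r, s, hr⟩ := (dle_of_adj ha h2).reach.exists_geo
    rw [mul_add]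
    rcases h.thin_forward hp hq hr hk with ⟨j, hj, hd⟩ | ⟨j, hj, hd⟩ <;> rw [← hκ] at hd
    · obtain ⟨i, hi, hi', hd'⟩ := ih h1 (by omega) hq j hj
      exact ⟨i, hi, hi'.trans h2, (hd.trans hd').mono (by omega)⟩
    · obtain ⟨i, hi, hi', hd'⟩ := ih h2 (by omega) hr j hj
      exact ⟨i, h1.trans hi, hi', (hd.trans hd').mono (by omega)⟩

/-- Cut the path at powers of two: passing to the block of index `M` costs `κ` per block, and
bisecting inside it costs about `κ * M`. The bound is thus logarithmic in the index `i ≥ 2 ^ M` that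
is found. -/
theorem Hyp.exists_dle_log (h : Hyp D Δ g) {κ : ℕ} (hκ : κ = g (Δ + 1) + 4 * Δ + 2)
    {a : ℕ → V} (ha : ∀ i, D.Adj (a i) (a (i + 1))) (k : ℕ) :
    ∀ {L n n' l : ℕ} {p : ℕ → V}, 2 ^ L ≤ n → n ≤ 2 ^ (L + 1) → n ≤ n' → n' ≤ 2 ^ (L + k) →
      Geo D p l (a n) (a n') → ∀ t ≤ l,
        ∃ M i, L ≤ M ∧ 2 ^ M ≤ i ∧ n ≤ i ∧ Dle D (p t) (a i) (κ * (M - L) + κ * (M + 1) + 1) := by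
  induction k with
  | zero =>
    intro L n n' l p hn hn2 hnn' hn' hp t ht
    obtain ⟨i, hi, -, hd⟩ := h.exists_dle_of_le_two_pow hκ ha L hnn' (by simp at hn'; omega) hp t ht
    exact ⟨L, i, le_rfl, hn.trans hi, hi, hd.mono (by rw [mul_add]; omega)⟩
  | succ k ih =>
    intro L n n' l p hn hn2 hnn' hn' hp t ht
    have hpow : 2 ^ (L + 1) = 2 * 2 ^ L := by rw [pow_succ, mul_comm]
    by_cases hle : n' ≤ 2 ^ (L + 1)
    · obtain ⟨i, hi, -, hd⟩ := h.exists_dle_of_le_two_pow hκ ha L hnn' (by omega) hp t ht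
      exact ⟨L, i, le_rfl, hn.trans hi, hi, hd.mono (by rw [mul_add]; omega)⟩
    · obtain ⟨q, m, hq⟩ := (dle_of_adj ha hn2).reach.exists_geo
      obtain ⟨r, s, hr⟩ := (dle_of_adj ha (not_le.1 hle).le).reach.exists_geo
      rcases h.thin_forward hp hq hr ht with ⟨j, hj, hd⟩ | ⟨j, hj, hd⟩ <;> rw [← hκ] at hd
      · obtain ⟨i, hi, -, hd'⟩ := h.exists_dle_of_le_two_pow hκ ha L hn2 (by omega) hq j hj
        exact ⟨L, i, le_rfl, hn.trans hi, hi, (hd.trans hd').mono (by rw [mul_add]; omega)⟩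
      · obtain ⟨M, i, hM, hMi, hi, hd'⟩ := ih le_rfl (by rw [pow_succ 2 (L + 1)]; omega)
          (not_le.1 hle).le (by rwa [add_right_comm, add_assoc]) hr j hj
        refine ⟨M, i, by omega, hMi, hn2.trans hi, (hd.trans hd').mono ?_⟩
        obtain ⟨e, rfl⟩ := Nat.exists_eq_add_of_le hM
        rw [show L + 1 + e - (L + 1) = e by omega, show L + 1 + e - L = e + 1 by omega]
        linarith [mul_add κ e 1]

/-- A weak form of the stability of geodesics for quasi-geodesic rays: a vertex that lies on a
geodesic between two late vertices of the ray and that is not far from the first vertex of the ray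
is close to an early vertex of the ray. -/
theorem QRay.exists_dle (h : Hyp D Δ g) {a : ℕ → V} {c : ℕ} (ha : QRay D a c) (T : ℕ) :
    ∃ I, ∀ {n n' l : ℕ} {p : ℕ → V}, 1 ≤ n → n ≤ n' → Geo D p l (a n) (a n') → ∀ k ≤ l,
      Dle D (a 0) (p k) T → ∃ i, n ≤ i ∧ i ≤ I ∧ Dle D (p k) (a i) I := by
  obtain ⟨κ, hκ⟩ : ∃ κ, κ = g (Δ + 1) + 4 * Δ + 2 := ⟨_, rfl⟩
  -- The exponential outgrows an expression linear in `M`.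
  obtain ⟨M0, hM0⟩ : ∃ M0, ∀ M, M0 ≤ M → c * (T + (κ * M + κ * (M + 1) + 1)) + c < 2 ^ M := by
    have h1 : Filter.Tendsto (fun n : ℕ => (n : ℝ) ^ 1 / (2 : ℝ) ^ n) Filter.atTop (𝓝 0) :=
      tendsto_pow_const_div_const_pow_of_one_lt 1 (by norm_num)
    have h2 : Filter.Tendsto (fun n : ℕ => ((1 : ℝ) / 2) ^ n) Filter.atTop (𝓝 0) :=
      tendsto_pow_atTop_nhds_zero_of_lt_one (by norm_num) (by norm_num)
    have h3 := (h1.const_mul (2 * c * κ : ℝ)).add (h2.const_mul (c * (T + κ + 1) + c : ℝ))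
    rw [mul_zero, mul_zero, add_zero] at h3
    obtain ⟨M0, hM0⟩ := Filter.eventually_atTop.1 (h3.eventually (gt_mem_nhds one_pos))
    refine ⟨M0, fun M hM => ?_⟩
    have h4 := hM0 M hM
    have h5 : (0 : ℝ) < 2 ^ M := by positivity
    rw [one_div, inv_pow, ← div_eq_mul_inv, pow_one, ← mul_div_assoc, ← add_div,
      div_lt_one h5] at h4
    have h6 : ((c * (T + (κ * M + κ * (M + 1) + 1)) + c : ℕ) : ℝ) < ((2 ^ M : ℕ) : ℝ) := by
      push_cast
      linarith
    exact_mod_cast h6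
  refine ⟨T + (κ * M0 + κ * (M0 + 1) + 1) + c * (T + (κ * M0 + κ * (M0 + 1) + 1)) + c, ?_⟩
  intro n n' l p hn hnn' hp k hk hT
  have hn0 : n ≠ 0 := by omega
  obtain ⟨M, i, hLM, hMi, hni, hd⟩ := h.exists_dle_log hκ ha.adj n'
    (Nat.pow_log_le_self 2 hn0) (Nat.lt_pow_succ_log_self one_lt_two n).le hnn'
    (Nat.lt_two_pow_self.le.trans (Nat.pow_le_pow_right two_pos (Nat.le_add_left _ _))) hp k hk
  have hd' : Dle D (p k) (a i) (κ * M + κ * (M + 1) + 1) := hd.mono (by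
    have := Nat.mul_le_mul_left κ (Nat.sub_le M (Nat.log 2 n))
    omega)
  -- The index `i` is at least `2 ^ M`, but at most linear in `M` since `a i` is near `a 0`; hence
  -- `M ≤ M0`.
  have h1 := ha.quasi (Nat.zero_le i) (hT.trans hd')
  have hM : M ≤ M0 := by
    by_contra hM
    have := hM0 M (by omega)
    omega
  have h2 : κ * M + κ * (M + 1) + 1 ≤ κ * M0 + κ * (M0 + 1) + 1 := by gcongr
  have h3 : c * (T + (κ * M + κ * (M + 1) + 1)) ≤ c * (T + (κ * M0 + κ * (M0 + 1) + 1)) := by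
    gcongr
  exact ⟨i, hni, by omega, hd'.mono (by omega)⟩

end Ray

/-! ### Sequences that represent points of the bordification -/

section Rep

variable {V : Type*} {D : Digraph V} {Δ : ℕ} {g : ℕ → ℕ}

/-- The sequence is constant, a quasi-geodesic ray or a quasi-geodesic anti-ray. -/
def Rep (D : Digraph V) (a : ℕ → V) : Prop :=
  (∃ x, a = fun _ => x) ∨ (∃ c, QRay D a c) ∨ ∃ c, QRay (rev D) a c

/-- Late members of `b` can be reached from late members of `a`. -/
def LateReach (D : Digraph V) (a b : ℕ → V) : Prop :=
  ∀ N : ℕ, ∃ i j : ℕ, N ≤ i ∧ N ≤ j ∧ Reach D (a i) (b j)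

theorem hasGeodesics_iff {a b : ℕ → V} : HasGeodesics D a b ↔ LateReach D a b := by
  refine forall_congr' fun N => exists_congr fun i => exists_congr fun j =>
    and_congr_right fun _ => and_congr_right fun _ => ⟨?_, fun h => ?_⟩
  · rintro ⟨p, n, hp⟩
    exact (isGeodesic_iff.1 hp).dle.reach
  · obtain ⟨p, n, hp⟩ := h.exists_geo
    exact ⟨p, n, isGeodesic_iff.2 hp⟩

/-- The two middle vertices must be joined: on a ray the second is chosen later than the first, on
an anti-ray the first later than the second. -/
theorem LateReach.trans {a b c : ℕ → V} (hab : LateReach D a b) (hb : Rep D b)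
    (hbc : LateReach D b c) : LateReach D a c := by
  intro N
  rcases hb with ⟨x, rfl⟩ | ⟨k, hb⟩ | ⟨k, hb⟩
  · obtain ⟨i, _, hi, -, h1⟩ := hab N
    obtain ⟨_, j, -, hj, h2⟩ := hbc N
    exact ⟨i, j, hi, hj, h1.trans h2⟩
  · obtain ⟨i, j, hi, -, h1⟩ := hab N
    obtain ⟨j', l, hj', hl, h2⟩ := hbc (max N j)
    exact ⟨i, l, hi, le_of_max_le_left hl,
      (h1.trans (hb.reach (le_of_max_le_right hj'))).trans h2⟩
  · obtain ⟨j', l, -, hl, h2⟩ := hbc N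
    obtain ⟨i, j, hi, hj, h1⟩ := hab (max N j')
    exact ⟨i, l, le_of_max_le_left hi, hl,
      (h1.trans (reach_rev.1 (hb.reach (le_of_max_le_right hj)))).trans h2⟩

theorem Rep.lateReach_self {a : ℕ → V} : LateReach D a a :=
  fun N => ⟨N, N, le_rfl, le_rfl, Reach.refl _⟩

theorem QGRay.exists_qRay (R : QGRay D) : (∃ c, QRay D R.1 c) ∨ ∃ c, QRay (rev D) R.1 c :=
  R.2.imp IsQuasiGeodRay.exists_qRay
    fun h => (isQuasiGeodRay_rev.2 h).exists_qRay

theorem QGRay.rep (R : QGRay D) : Rep D R.1 := Or.inr R.exists_qRay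

theorem QGRay.leaves (h : Hyp D Δ g) (R : QGRay D) (x : V) (r : ℕ) :
    ∃ N, ∀ i, N ≤ i → ¬ Dle D x (R.1 i) r ∧ ¬ Dle D (R.1 i) x r := by
  rcases R.exists_qRay with ⟨c, hc⟩ | ⟨c, hc⟩
  · exact hc.leaves h x r
  · obtain ⟨N, hN⟩ := hc.leaves h.rev x r
    refine ⟨N, fun i hi => ?_⟩
    have := hN i hi
    rw [dle_rev, dle_rev] at this
    exact this.symm

/-- Avoiding a large ball around the start of `R₁` makes `i` large. Then `j` is large too, since
each early vertex of `R₂` is within distance `M` of only boundedly indexed vertices of `R₁`. -/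
theorem RayLE.lateReach (h : Hyp D Δ g) {R₁ R₂ : QGRay D} (hR : RayLE R₁ R₂) :
    LateReach D R₁.1 R₂.1 := by
  intro N
  obtain ⟨M, hM⟩ := hR
  choose I hI using fun j => R₁.leaves h (R₂.1 j) M
  obtain ⟨i, j, p, n, hn, hp, hav⟩ :=
    hM ((max N ((Finset.range N).sup I) : ℕ) : ℝ) (R₁.1 0) (Nat.cast_nonneg _)
  have hri : max N ((Finset.range N).sup I) ≤ i := by
    by_contra hlt
    refine hav (p 0) ⟨0, n.zero_le, rfl⟩ ?_
    rw [hp.1]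
    simp only [outBall, inBall, Set.mem_union, Set.mem_ofPred_eq, ENNReal.ofReal_natCast,
      ← dle_iff_dist_le]
    rcases R₁.exists_qRay with ⟨c, hc⟩ | ⟨c, hc⟩
    · exact Or.inl ((hc.dle (Nat.zero_le i)).mono (by omega))
    · exact Or.inr ((dle_rev.1 (hc.dle (Nat.zero_le i))).mono (by omega))
  refine ⟨i, j, le_of_max_le_left hri, ?_, n, p, n, le_rfl, hp⟩
  by_contra hj
  have h1 : I j ≤ (Finset.range N).sup I := Finset.le_sup (Finset.mem_range.2 (not_le.1 hj))
  exact (hI j i (h1.trans (le_of_max_le_right hri))).2 ⟨p, n, hn, hp⟩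

theorem RayLE.refl (h : Hyp D Δ g) (R : QGRay D) : RayLE R R := by
  refine ⟨0, fun r x _ => ?_⟩
  obtain ⟨N, hN⟩ := R.leaves h x ⌈r⌉₊
  refine ⟨N, N, fun _ => R.1 N, 0, le_rfl, ⟨rfl, rfl, fun i hi => absurd hi i.not_lt_zero⟩, ?_⟩
  rintro v ⟨i, -, rfl⟩ (hv | hv)
  · exact (hN N le_rfl).1 (dle_of_dist_le hv)
  · exact (hN N le_rfl).2 (dle_of_dist_le hv)

theorem RayEquiv.refl (h : Hyp D Δ g) (R : QGRay D) : RayEquiv R R :=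
  ⟨RayLE.refl h R, RayLE.refl h R⟩

/-- The boundary point of a quasi-geodesic ray or anti-ray. -/
def boundaryPoint (R : QGRay D) : Boundary D := ⟨{Q | RayEquiv R Q}, R, rfl⟩

theorem mem_reps_boundaryPoint (h : Hyp D Δ g) (R : QGRay D) :
    R.1 ∈ reps (Sum.inr (boundaryPoint R)) :=
  ⟨R, RayEquiv.refl h R, rfl⟩

theorem reps_nonempty (h : Hyp D Δ g) (η : Bordification D) : ∃ a, a ∈ reps η := by
  rcases η with x | ⟨C, R, rfl⟩
  · exact ⟨fun _ => x, rfl⟩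
  · exact ⟨R.1, R, RayEquiv.refl h R, rfl⟩

theorem rep_of_mem_reps {η : Bordification D} {a : ℕ → V} (ha : a ∈ reps η) : Rep D a := by
  rcases η with x | ⟨C, R, rfl⟩
  · exact Or.inl ⟨x, ha⟩
  · obtain ⟨Q, -, rfl⟩ := ha
    exact Q.rep

theorem lateReach_of_mem_reps (h : Hyp D Δ g) {η : Bordification D} {a b : ℕ → V}
    (ha : a ∈ reps η) (hb : b ∈ reps η) : LateReach D a b := by
  rcases η with x | ⟨C, R, rfl⟩
  · obtain rfl : a = fun _ => x := ha
    obtain rfl : b = fun _ => x := hb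
    exact Rep.lateReach_self
  · obtain ⟨Q, hQ, rfl⟩ := ha
    obtain ⟨Q', hQ', rfl⟩ := hb
    exact (hQ.2.lateReach h).trans R.rep (hQ'.1.lateReach h)

theorem exists_lateReach_of_rho_lt_top {S : Finset V} (hS : S.Nonempty) {ε : ℝ}
    {η μ : Bordification D} (hlt : rho S ε η μ < ⊤) :
    ∃ a ∈ reps η, ∃ b ∈ reps μ, LateReach D a b := by
  obtain ⟨s, hs⟩ := hS
  have h1 : rhoPt ε s η μ < ⊤ :=
    (Finset.le_sup (f := fun s => rhoPt ε s η μ) hs).trans_lt hlt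
  simp only [rhoPt, iInf_lt_iff] at h1
  obtain ⟨a, ha, b, hb, hab⟩ := h1
  refine ⟨a, ha, b, hb, hasGeodesics_iff.1 ?_⟩
  by_contra hn
  simp [geodExp, hn] at hab

/-- Each link of a finite-cost chain gives late reachability for some representatives; these compose
because any two representatives of one point reach each other late. -/
theorem lateReach_of_bdDist_lt_top (h : Hyp D Δ g) {S : Finset V} (hS : S.Nonempty) {ε : ℝ}
    {η μ : Bordification D} (hlt : bdDist D S ε η μ < ⊤) {a b : ℕ → V} (ha : a ∈ reps η)
    (hb : b ∈ reps μ) : LateReach D a b := by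
  simp only [bdDist, iInf_lt_iff] at hlt
  obtain ⟨n, c, rfl, rfl, hsum⟩ := hlt
  have hrho : ∀ i < n, rho S ε (c i) (c (i + 1)) < ⊤ := fun i hi =>
    ENNReal.sum_lt_top.1 hsum i (Finset.mem_range.2 hi)
  clear hsum
  induction n generalizing b with
  | zero => exact lateReach_of_mem_reps h ha hb
  | succ n ih =>
    obtain ⟨e, he⟩ := reps_nonempty h (c n)
    obtain ⟨a', ha', b', hb', hab⟩ := exists_lateReach_of_rho_lt_top hS (hrho n (by omega))
    have h1 := ih he fun i hi => hrho i (by omega)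
    exact ((h1.trans (rep_of_mem_reps he) (lateReach_of_mem_reps h he ha')).trans
      (rep_of_mem_reps ha') hab).trans (rep_of_mem_reps hb') (lateReach_of_mem_reps h hb' hb)

/-- Geodesics between late members of the sequences avoid the balls of radius `K` around `s`. -/
def FarFrom (D : Digraph V) (s : V) (K : ℕ) (a b : ℕ → V) : Prop :=
  ∃ N : ℕ, ∀ i j, N ≤ i → N ≤ j → ∀ (p : ℕ → V) (n : ℕ), Geo D p n (a i) (b j) → ∀ l ≤ n,
    ¬ Dle D s (p l) K ∧ ¬ Dle D (p l) s K

theorem FarFrom.le_geodLiminf {s : V} {K : ℕ} {a b : ℕ → V} (h : FarFrom D s K a b) :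
    (K : ℝ≥0∞) ≤ geodLiminf D s a b := by
  obtain ⟨N, hN⟩ := h
  refine le_iSup_of_le N ?_
  refine le_iInf fun i => le_iInf fun j => le_iInf fun hi => le_iInf fun hj => le_iInf fun p =>
    le_iInf fun n => le_iInf fun hp => le_iInf fun l => le_iInf fun hl => le_min ?_ ?_
  · have := (hN i j hi hj p n (isGeodesic_iff.1 hp) l hl).1
    rw [dle_iff_dist_le] at this
    exact (not_le.1 this).le
  · have := (hN i j hi hj p n (isGeodesic_iff.1 hp) l hl).2
    rw [dle_iff_dist_le] at this
    exact (not_le.1 this).le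

theorem bdDist_le_rho (S : Finset V) (ε : ℝ) (η μ : Bordification D) :
    bdDist D S ε η μ ≤ rho S ε η μ := by
  refine iInf_le_of_le 1 (iInf_le_of_le (fun i => if i = 0 then η else μ) ?_)
  refine iInf_le_of_le (by simp) (iInf_le_of_le (by simp) ?_)
  simp

theorem bdDist_le_of_farFrom {S : Finset V} {ε : ℝ} (hε : 0 < ε) {η μ : Bordification D}
    {a b : ℕ → V} (ha : a ∈ reps η) (hb : b ∈ reps μ) (hab : LateReach D a b) {K : ℕ}
    (hfar : ∀ s ∈ S, FarFrom D s K a b) :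
    bdDist D S ε η μ ≤ ENNReal.ofReal (Real.exp (-(ε * K))) := by
  refine (bdDist_le_rho S ε η μ).trans (Finset.sup_le fun s hs => ?_)
  refine (iInf₂_le_of_le a ha (iInf₂_le b hb)).trans ?_
  rw [geodExp, if_pos (hasGeodesics_iff.2 hab), ← EReal.exp_coe]
  refine EReal.exp_monotone ?_
  rw [EReal.coe_neg, EReal.neg_le_neg_iff]
  have h1 : ENNReal.ofReal (ε * K) ≤ ENNReal.ofReal ε * geodLiminf D s a b := by
    rw [ENNReal.ofReal_mul hε.le, ENNReal.ofReal_natCast]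
    exact mul_le_mul_right (hfar s hs).le_geodLiminf _
  refine le_trans ?_ (EReal.coe_ennreal_le_coe_ennreal_iff.2 h1)
  rw [EReal.coe_ennreal_ofReal]
  exact_mod_cast le_max_left _ _

theorem tendsto_ofReal_exp_neg_mul {ε : ℝ} (hε : 0 < ε) :
    Filter.Tendsto (fun K : ℕ => ENNReal.ofReal (Real.exp (-(ε * K)))) Filter.atTop (𝓝 0) := by
  rw [← ENNReal.ofReal_zero]
  refine ENNReal.tendsto_ofReal (Real.tendsto_exp_atBot.comp ?_)
  exact Filter.tendsto_neg_atTop_atBot.comp (tendsto_natCast_atTop_atTop.const_mul_atTop hε)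

end Rep

/-! ### Local finiteness -/

section Finite

variable {V : Type*} {D : Digraph V} {Δ : ℕ} {g : ℕ → ℕ}

theorem OutFinite.finite_adj (hD : OutFinite D) (x : V) : {y | D.Adj x y}.Finite := by
  -- A loop at `x` is not counted by distance one, hence the inserted point.
  refine ((hD x).insert x).subset fun y hy => ?_
  by_cases hyx : y = x
  · exact Or.inl hyx
  · refine Or.inr (le_antisymm ?_ ?_)
    · simpa using dle_iff_dist_le.1 (Dle.of_adj hy)
    · by_contra hlt
      have h1 : dist D x y < ((1 : ℕ) : ℝ≥0∞) := by simpa using hlt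
      simp only [dist, iInf_lt_iff] at h1
      obtain ⟨p, n, hp, hn⟩ := h1
      have hn' : n < 1 := by exact_mod_cast hn
      obtain rfl : n = 0 := by omega
      exact hyx (hp.2.1.symm.trans hp.1)

theorem OutFinite.finite_dle (hD : OutFinite D) (x : V) (n : ℕ) : {y | Dle D x y n}.Finite := by
  induction n with
  | zero =>
    refine (Set.finite_singleton x).subset ?_
    rintro y ⟨p, m, hm, hp⟩
    obtain rfl : m = 0 := by omega
    exact hp.2.1.symm.trans hp.1
  | succ n ih =>
    refine (ih.union (ih.biUnion fun y _ => hD.finite_adj y)).subset ?_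
    rintro y ⟨p, m, hm, hp⟩
    by_cases hmn : m ≤ n
    · exact Or.inl ⟨p, m, hmn, hp⟩
    · obtain ⟨k, rfl⟩ : ∃ k, m = k + 1 := ⟨m - 1, by omega⟩
      refine Or.inr (Set.mem_biUnion (x := p k) ?_ ?_)
      · have := hp.dle_apply (Nat.zero_le k) (Nat.le_succ k)
        rw [hp.1] at this
        exact this.mono (by omega)
      · have := hp.2.2 k (Nat.lt_succ_self k)
        rwa [hp.2.1] at this

end Finite

/-! ### Anti-rays and vertices between them -/

section AntiRay

variable {V : Type*} {D : Digraph V} {Δ : ℕ} {g : ℕ → ℕ}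

theorem QRay.reach_of_rev {a : ℕ → V} {c : ℕ} (ha : QRay (rev D) a c) {i j : ℕ} (hij : i ≤ j) :
    Reach D (a j) (a i) := reach_rev.1 (ha.reach hij)

theorem QRay.dle_of_rev {a : ℕ → V} {c : ℕ} (ha : QRay (rev D) a c) {i j : ℕ} (hij : i ≤ j) :
    Dle D (a j) (a i) (j - i) := dle_rev.1 (ha.dle hij)

theorem QRay.leaves_of_rev (h : Hyp D Δ g) {a : ℕ → V} {c : ℕ} (ha : QRay (rev D) a c) (x : V)
    (r : ℕ) : ∃ N, ∀ i, N ≤ i → ¬ Dle D x (a i) r ∧ ¬ Dle D (a i) x r := by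
  obtain ⟨N, hN⟩ := ha.leaves h.rev x r
  refine ⟨N, fun i hi => ?_⟩
  have := hN i hi
  rw [dle_rev, dle_rev] at this
  exact this.symm

theorem QRay.exists_dle_of_rev (h : Hyp D Δ g) {a : ℕ → V} {c : ℕ} (ha : QRay (rev D) a c)
    (T : ℕ) : ∃ I, ∀ {n n' l : ℕ} {p : ℕ → V}, 1 ≤ n → n ≤ n' → Geo D p l (a n') (a n) → ∀ k ≤ l,
      Dle D (p k) (a 0) T → ∃ i, n ≤ i ∧ i ≤ I ∧ Dle D (a i) (p k) I := by
  obtain ⟨I, hI⟩ := ha.exists_dle h.rev T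
  refine ⟨I, fun {n n' l p} hn hnn' hp k hk hT => ?_⟩
  have := hI hn hnn' hp.rev (l - k) (Nat.sub_le _ _)
  rw [show l - (l - k) = k by omega] at this
  obtain ⟨i, hi, hi', hd⟩ := this (dle_rev.2 hT)
  exact ⟨i, hi, hi', dle_rev.1 hd⟩

theorem exists_bound_of_finite {α : Type*} {C : Set α} (hC : C.Finite) {P : α → ℕ → Prop}
    (hP : ∀ x, ∃ N, P x N) (hmono : ∀ x N N', N ≤ N' → P x N → P x N') :
    ∃ N, ∀ x ∈ C, P x N := by
  choose N hN using hP
  obtain ⟨M, hM⟩ := (hC.image N).bddAbove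
  exact ⟨M, fun x hx => hmono x _ _ (hM (Set.mem_image_of_mem N hx)) (hN x)⟩

/-- Geodesics between late vertices of a quasi-geodesic ray are far from every vertex. -/
theorem QRay.exists_side (h : Hyp D Δ g) (hO : OutFinite D) {a : ℕ → V} {c : ℕ}
    (ha : QRay D a c) (o : V) (T : ℕ) : ∃ N, ∀ n n', N ≤ n → n ≤ n' →
      ∀ (p : ℕ → V) (l : ℕ), Geo D p l (a n) (a n') → ∀ k ≤ l, ¬ Dle D o (p k) T := by
  obtain ⟨N, hN⟩ := exists_bound_of_finite (hO.finite_dle o T)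
    (P := fun v N => ∀ n n', N ≤ n → n ≤ n' → ∀ (p : ℕ → V) (l : ℕ), Geo D p l (a n) (a n') →
      ∀ k ≤ l, p k ≠ v) (fun v => by
      -- If `a 0` reaches `v`, stability bounds `n`; if not, no geodesic between ray vertices
      -- contains `v`, as `a 0` reaches all its vertices.
      by_cases hv : Reach D (a 0) v
      · obtain ⟨t, ht⟩ := hv
        obtain ⟨I, hI⟩ := ha.exists_dle h t
        refine ⟨I + 1, fun n n' hn hn' p l hp k hk hkv => ?_⟩
        obtain ⟨i, hi, hi', -⟩ := hI (by omega) hn' hp k hk (by rwa [hkv])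
        omega
      · refine ⟨0, fun n n' hn hn' p l hp k hk hkv => hv ?_⟩
        rw [← hkv]
        exact (ha.reach (Nat.zero_le n)).trans (hp.dle_left hk).reach)
    (fun v N N' hNN' hP n n' hn => hP n n' (hNN'.trans hn))
  exact ⟨N, fun n n' hn hn' p l hp k hk hd => hN _ hd n n' hn hn' p l hp k hk rfl⟩

/-- Reversal does not reduce this to the case of rays: both cases use finite out-balls. -/
theorem QRay.exists_side_of_rev (h : Hyp D Δ g) (hO : OutFinite D) {a : ℕ → V} {c : ℕ}
    (ha : QRay (rev D) a c) (o : V) (T : ℕ) : ∃ N, ∀ n n', N ≤ n → n ≤ n' →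
      ∀ (p : ℕ → V) (l : ℕ), Geo D p l (a n') (a n) → ∀ k ≤ l, ¬ Dle D o (p k) T := by
  obtain ⟨N, hN⟩ := exists_bound_of_finite (hO.finite_dle o T)
    (P := fun v N => ∀ n n', N ≤ n → n ≤ n' → ∀ (p : ℕ → V) (l : ℕ), Geo D p l (a n') (a n) →
      ∀ k ≤ l, p k ≠ v) (fun v => by
      by_cases hv : Reach D v (a 0)
      · obtain ⟨t, ht⟩ := hv
        obtain ⟨I, hI⟩ := ha.exists_dle_of_rev h t
        refine ⟨I + 1, fun n n' hn hn' p l hp k hk hkv => ?_⟩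
        obtain ⟨i, hi, hi', -⟩ := hI (by omega) hn' hp k hk (by rwa [hkv])
        omega
      · refine ⟨0, fun n n' hn hn' p l hp k hk hkv => hv ?_⟩
        rw [← hkv]
        exact (hp.dle_right hk).reach.trans (ha.reach_of_rev (Nat.zero_le n)))
    (fun v N N' hNN' hP n n' hn => hP n n' (hNN'.trans hn))
  exact ⟨N, fun n n' hn hn' p l hp k hk hd => hN _ hd n n' hn hn' p l hp k hk rfl⟩

/-- Some vertex is reachable from the anti-ray `a` and reaches all vertices of the
anti-ray `b`. -/
def HasVertexBetween (D : Digraph V) (a b : ℕ → V) : Prop :=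
  ∃ v, (∃ n, Reach D (a n) v) ∧ ∀ m, Reach D v (b m)

/-- If there is no vertex between two anti-rays, then geodesics from one to the other are far
from every vertex. -/
theorem farFrom_of_not_hasVertexBetween (h : Hyp D Δ g) (hO : OutFinite D) {a b : ℕ → V}
    {c c' : ℕ} (ha : QRay (rev D) a c) (hb : QRay (rev D) b c')
    (hab : ¬ HasVertexBetween D a b) (s : V) (K : ℕ) : FarFrom D s K a b := by
  -- A vertex that `a` reaches misses some `b m`, hence all later ones, so late geodesics avoid any
  -- given finite set. This settles the out-ball of `s`.
  have hfin : ∀ C : Set V, C.Finite → ∃ N, ∀ v ∈ C, ∀ n m, N ≤ n → N ≤ m →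
      Reach D (a n) v → ¬ Reach D v (b m) := by
    intro C hC
    refine exists_bound_of_finite hC (P := fun v N => ∀ n m, N ≤ n → N ≤ m →
      Reach D (a n) v → ¬ Reach D v (b m)) (fun v => ?_)
      (fun v N N' hNN' hP n m hn hm => hP n m (hNN'.trans hn) (hNN'.trans hm))
    by_cases hv : ∃ n, Reach D (a n) v
    · obtain ⟨m, hm⟩ : ∃ m, ¬ Reach D v (b m) := by
        by_contra hcon
        push Not at hcon
        exact hab ⟨v, hv, hcon⟩
      exact ⟨m, fun n m' _ hm' _ hr => hm (hr.trans (hb.reach_of_rev hm'))⟩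
    · exact ⟨0, fun n m _ _ hr => absurd ⟨n, hr⟩ hv⟩
  obtain ⟨N1, hN1⟩ := hfin _ (hO.finite_dle s K)
  have hout : ∀ n m, N1 ≤ n → N1 ≤ m → ∀ (p : ℕ → V) (l : ℕ), Geo D p l (a n) (b m) →
      ∀ k ≤ l, ¬ Dle D s (p k) K := fun n m hn hm p l hp k hk hd =>
    hN1 _ hd n m hn hm (hp.dle_left hk).reach (hp.dle_right hk).reach
  by_cases hs : ∃ n, Reach D (a n) s
  swap
  · exact ⟨N1, fun n m hn hm p l hp k hk => ⟨hout n m hn hm p l hp k hk, fun hd =>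
      hs ⟨n, (hp.dle_left hk).reach.trans hd.reach⟩⟩⟩
  obtain ⟨n1, hn1, hs⟩ : ∃ n1, 1 ≤ n1 ∧ Reach D (a n1) s := by
    obtain ⟨n, hn⟩ := hs
    exact ⟨n + 1, by omega, (ha.reach_of_rev (Nat.le_succ n)).trans hn⟩
  obtain ⟨L, ell, hL⟩ := hs.exists_geo
  -- For the in-ball, a vertex `p k` near `s` is compared with the vertex `t` steps before it; `t`
  -- exceeds both bounds that (B1) and (B2) would give for their distance.
  obtain ⟨X, hX⟩ : ∃ X, X = g (max (Δ + ell) K) := ⟨_, rfl⟩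
  obtain ⟨t, ht⟩ : ∃ t, t = g (max (Δ + K) K) + g (max Δ X) + 1 := ⟨_, rfl⟩
  obtain ⟨I, hI⟩ := ha.exists_dle_of_rev h (g (max (Δ + (Δ + (t + K))) ell) + n1)
  obtain ⟨N2, hN2⟩ := hfin _ ((Set.finite_Iic I).biUnion
    fun i _ => hO.finite_dle (a i) (I + (Δ + (Δ + t))))
  obtain ⟨N3, hN3⟩ := ha.leaves_of_rev h s (t + K)
  refine ⟨max N1 (max N2 (max N3 n1)), fun n m hn hm p l hp k hk =>
    ⟨hout n m (by omega) (by omega) p l hp k hk, fun hd => ?_⟩⟩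
  have htk : t ≤ k := by
    by_contra hlt
    exact (hN3 n (by omega)).2 (((hp.dle_left hk).mono (by omega)).trans hd)
  have hwv : Dle D (p (k - t)) (p k) t := (hp.dle_apply (by omega) hk).mono (by omega)
  obtain ⟨Y, y, hy, hY⟩ := hd.exists_geo
  obtain ⟨G, lG, hG⟩ := ((hp.dle_left hk).reach.trans hd.reach).exists_geo
  obtain ⟨A, lA, hA⟩ := (ha.reach_of_rev (show n1 ≤ n by omega)).exists_geo
  have hnot : ∀ r, r < t → ¬ Dle D (p (k - t)) (p k) r := fun r hr hd' => by
    have := hp.le_of_dle (by omega) hk hd'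
    omega
  -- Only one alternative is compatible with `t`: `A i` leads to `p k` by a short path. Then `A i`
  -- is near an early vertex of the anti-ray, so `p k` lies in the finite set excluded by `N2`.
  rcases h.thin (hp.take hk) (Or.inl hG) (Or.inl hY) (k - t) (by omega) with
    ⟨j, hj, hdj⟩ | ⟨j, hj, hdj⟩
  · rcases h.thin hG (Or.inl hA) (Or.inr hL) j hj with ⟨i, hi, hdi⟩ | ⟨i, hi, hdi⟩
    · have h1 : Dle D (A i) s (Δ + (Δ + (t + K))) := hdi.trans (hdj.trans (hwv.trans hd))
      have h2 := h.b2' h1 hL.dle (hA.dle_right hi).reach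
      have h3 := h2.trans (ha.dle_of_rev (Nat.zero_le n1))
      obtain ⟨e, he, heI, hde⟩ := hI hn1 (by omega) hA i hi (h3.mono (by omega))
      exact hN2 (p k) (Set.mem_biUnion (x := e) heI (hde.trans (hdi.trans (hdj.trans hwv)))) n m
        (by omega) (by omega) (hp.dle_left hk).reach (hp.dle_right hk).reach
    · have h1 : Dle D (G j) s (Δ + ell) := (hdi.trans (hL.dle_right hi)).mono (by omega)
      have h2 := h.b2' h1 hd (hdj.trans hwv).reach
      rw [← hX] at h2
      exact hnot _ (by omega) (h.b1' hdj h2 hwv.reach)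
  · have h1 : Dle D (p (k - t)) s (Δ + K) := (hdj.trans (hY.dle_right hj)).mono (by omega)
    exact hnot _ (by omega) (h.b2' h1 hd hwv.reach)

/-- If there is no vertex between two anti-rays, then reachability is symmetric. -/
theorem LateReach.symm_of_not_hasVertexBetween (h : Hyp D Δ g) (hO : OutFinite D) {a b : ℕ → V}
    {c c' : ℕ} (ha : QRay (rev D) a c) (hb : QRay (rev D) b c') (hlate : LateReach D a b)
    (hab : ¬ HasVertexBetween D a b) : LateReach D b a := by
  intro N
  obtain ⟨n0, m0, hn0, hm0, hr0⟩ := hlate N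
  obtain ⟨L, ell, hL⟩ := hr0.exists_geo
  obtain ⟨t2, ht2⟩ : ∃ t, t = g (max (Δ + ell) ell) + 1 := ⟨_, rfl⟩
  -- This choice places `G j` before `G i` below, so that `G` leads from near `H` to near `A`.
  obtain ⟨t, ht⟩ : ∃ t, t = 2 * Δ + t2 + ell + 1 := ⟨_, rfl⟩
  obtain ⟨N1, hN1⟩ := farFrom_of_not_hasVertexBetween h hO ha hb hab (b m0) (Δ + t)
  obtain ⟨N2, hN2⟩ := hb.leaves_of_rev h (b m0) t
  obtain ⟨N3, hN3⟩ := ha.leaves_of_rev h (a n0) t2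
  obtain ⟨n, m, hn, hm, hr⟩ := hlate (max (max n0 m0) (max N1 (max N2 N3)))
  refine ⟨m, n0, by omega, hn0, ?_⟩
  have hbr := hb.reach_of_rev (show m0 ≤ m by omega)
  have har := ha.reach_of_rev (show n0 ≤ n by omega)
  obtain ⟨H, lH, hH⟩ := hbr.exists_geo
  obtain ⟨A, lA, hA⟩ := har.exists_geo
  obtain ⟨F, lF, hF⟩ := hr.exists_geo
  obtain ⟨G, lG, hG⟩ := (har.trans hr0).exists_geo
  have hlH : t < lH := by
    by_contra hlt
    exact (hN2 m (by omega)).2 (hH.dle.mono (not_lt.1 hlt))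
  have hlA : t2 < lA := by
    by_contra hlt
    exact (hN3 n (by omega)).2 (hA.dle.mono (not_lt.1 hlt))
  have hHr : Dle D (H (lH - t)) (b m0) t := (hH.dle_right (by omega)).mono (by omega)
  have hAr : Dle D (A (lA - t2)) (a n0) t2 := (hA.dle_right (by omega)).mono (by omega)
  -- Being near `F` is excluded because `F` is far from `b m0`; hence `H` leads to `G`.
  rcases h.thin hH (Or.inr hF) (Or.inr hG) (lH - t) (by omega) with ⟨j, hj, hdj⟩ | ⟨j, hj, hdj⟩
  · exact absurd (hdj.trans hHr) (hN1 n m (by omega) (by omega) F lF hF j hj).2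
  rcases h.thin hA (Or.inl hG) (Or.inl hL) (lA - t2) (by omega) with ⟨i, hi, hdi⟩ | ⟨i, hi, hdi⟩
  · have h1 := hG.le_of_dle_right hi (hdi.trans (hAr.trans hL.dle))
    have h2 := hH.le_of_dle_right (by omega) (hdj.trans (hG.dle_right hj))
    exact (hH.dle_left (by omega)).reach.trans (hdj.reach.trans
      ((hG.dle_apply (show j ≤ i by omega) hi).reach.trans (hdi.trans hAr).reach))
  · have h1 : Dle D (A (lA - t2)) (b m0) (Δ + ell) :=
      (hdi.trans (hL.dle_right hi)).mono (by omega)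
    have h2 := hA.le_of_dle_right (by omega) (h.b2' h1 hL.dle hAr.reach)
    omega

theorem bdDist_eq_zero_of_not_hasVertexBetween (h : Hyp D Δ g) (hO : OutFinite D)
    {S : Finset V} {ε : ℝ} (hε : 0 < ε) {η μ : Bordification D} {a b : ℕ → V} (haη : a ∈ reps η)
    (hbμ : b ∈ reps μ) {c c' : ℕ} (ha : QRay (rev D) a c) (hb : QRay (rev D) b c')
    (hlate : LateReach D a b) (hab : ¬ HasVertexBetween D a b) : bdDist D S ε μ η = 0 := by
  have hba : ¬ HasVertexBetween D b a := by
    rintro ⟨v, ⟨m, hm⟩, hv⟩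
    refine hab ⟨v, ?_, fun m' => ?_⟩
    · obtain ⟨i, j, -, hj, hr⟩ := hlate m
      exact ⟨i, hr.trans ((hb.reach_of_rev hj).trans hm)⟩
    · obtain ⟨i, j, -, hj, hr⟩ := hlate m'
      exact (hv i).trans (hr.trans (hb.reach_of_rev hj))
  have key : ∀ K : ℕ, bdDist D S ε μ η ≤ ENNReal.ofReal (Real.exp (-(ε * K))) := fun K =>
    bdDist_le_of_farFrom hε hbμ haη (hlate.symm_of_not_hasVertexBetween h hO ha hb hab)
      fun s _ => farFrom_of_not_hasVertexBetween h hO hb ha hba s K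
  exact le_antisymm (ge_of_tendsto' (tendsto_ofReal_exp_neg_mul hε) key) zero_le

end AntiRay

/-! ### Convergence to a boundary point -/

section Limit

variable {V : Type*} {D : Digraph V} {Δ : ℕ} {g : ℕ → ℕ}

theorem Geo.congr {p q : ℕ → V} {n : ℕ} {x y : V} (hp : Geo D p n x y)
    (hpq : ∀ i ≤ n, p i = q i) : Geo D q n x y where
  path := ⟨by rw [← hpq 0 n.zero_le, hp.zero], by rw [← hpq n le_rfl, hp.last], fun i hi => by
    rw [← hpq i hi.le, ← hpq (i + 1) hi]
    exact hp.path.2.2 i hi⟩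
  min := hp.min

/-- If `y` and `x` are joined by a geodesic far from `o`, then early vertices of a geodesic from
`o` to `y` are close to every geodesic from `o` to `x`. -/
theorem Hyp.exists_dle_of_side (h : Hyp D Δ g) {o x y : V} {p P r : ℕ → V} {l lP n T t : ℕ}
    (hp : Geo D p l o y) (hP : Geo D P lP o x) (hr : Geo D r n y x ∨ Geo D r n x y)
    (hfar : ∀ j ≤ n, ¬ Dle D o (r j) T) (htl : t ≤ l) (htT : t + Δ ≤ T) :
    ∃ j ≤ lP, t ≤ j + Δ ∧ Dle D (P j) (p t) Δ := by
  rcases h.thin hp (Or.inl hP) hr t htl with ⟨j, hj, hd⟩ | ⟨j, hj, hd⟩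
  · exact ⟨j, hj, hp.le_of_dle_left htl ((hP.dle_left hj).trans hd), hd⟩
  · exact absurd (((hp.dle_left htl).trans hd).mono htT) (hfar j hj)

/-- Geodesics from `x` to late vertices of the geodesic ray `R` from `o` are far from `o` if
geodesics from `o` to `x` and `R` stay together for a long time. -/
theorem Hyp.not_dle_of_agree (h : Hyp D Δ g) {o x y : V} {R p r q : ℕ → V}
    {l lq n m K T : ℕ} (hR : ∀ m, Geo D R m o (R m)) (hp : Geo D p l o y)
    (hox : Reach D o x) (hr : Geo D r n y x ∨ Geo D r n x y)
    (hfar : ∀ j ≤ n, ¬ Dle D o (r j) T) (hq : Geo D q lq x (R m)) {B : ℕ}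
    (hB : B = K + 2 * Δ + 2 + g (Δ + g (2 * Δ))) (hBl : B ≤ l) (hpR : ∀ t ≤ B, p t = R t)
    (hBT : B + Δ ≤ T) (hBm : B ≤ m) {i : ℕ} (hi : i ≤ lq) : ¬ Dle D o (q i) K := by
  intro hd
  obtain ⟨P, lP, hP⟩ := hox.exists_geo
  obtain ⟨Y, lY, hlY, hY⟩ := hd.exists_geo
  -- Both `q i1` with `i1 ≤ i` and `q (i + i2)` are near `P j`, so (B1) bounds `i2` by `g (2 * Δ)`;
  -- thus all these `R t` reach one common vertex of `q`.
  have key : ∀ t, K + 2 * Δ < t → t ≤ B →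
      Dle D (R t) (q (min lq (i + g (2 * Δ)))) (Δ + g (2 * Δ)) := by
    intro t ht htB
    obtain ⟨j, hj, htj, hdj⟩ := h.exists_dle_of_side hp hP hr hfar (htB.trans hBl)
      (t := t) (by omega)
    rw [hpR t htB] at hdj
    obtain ⟨i1, hi1, hd1⟩ : ∃ i1 ≤ i, Dle D (P j) (q i1) Δ := by
      rcases h.thin hP (Or.inl hY) (Or.inl (hq.take hi)) j hj with ⟨e, he, hde⟩ | ⟨e, he, hde⟩
      · have := hP.le_of_dle_left hj ((hY.dle_left he).trans hde)
        omega
      · exact ⟨e, he, hde⟩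
    obtain ⟨i2, hi2, hd2⟩ : ∃ i2 ≤ lq - i, Dle D (R t) (q (i + i2)) Δ := by
      rcases h.thin (hR m) (Or.inl hY) (Or.inr (hq.drop hi)) t (htB.trans hBm) with
        ⟨e, he, hde⟩ | ⟨e, he, hde⟩
      · have := (hR m).le_of_dle_left (htB.trans hBm) ((hY.dle_left he).trans hde)
        omega
      · exact ⟨e, he, hde⟩
    have h1 := h.b1 (hd1.mono (by omega)) ((hdj.trans hd2).mono (by omega : Δ + Δ ≤ 2 * Δ))
      (hq.dle_apply (by omega) (by omega)).reach
    have h2 := hq.le_of_dle (by omega) (by omega) h1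
    exact (hd2.trans (hq.dle_apply (by omega : i + i2 ≤ min lq (i + g (2 * Δ)))
      (by omega))).mono (by omega)
  -- By (B2) the two ray vertices are at distance at most `g (Δ + g (2 * Δ))`, but `B` puts them one
  -- step further apart.
  have h1 := h.b2 (key (K + 2 * Δ + 1) (by omega) (by omega)) (key B (by omega) le_rfl)
    ((hR B).dle_apply (by omega) le_rfl).reach
  have h2 := (hR B).le_of_dle (by omega) le_rfl h1
  omega

/-- If `x` reaches a vertex `z` such that geodesics from `o` to `z` stay close to the ray `R` for a
long time, then `x` reaches `R`. -/
theorem Hyp.reach_of_agree (h : Hyp D Δ g) {o x y z : V} {p r : ℕ → V} {l n T C t : ℕ}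
    (hp : Geo D p l o y) (hox : Dle D o x C) (hxz : Reach D x z)
    (hr : Geo D r n y z ∨ Geo D r n z y) (hfar : ∀ j ≤ n, ¬ Dle D o (r j) T)
    (ht : t = C + 3 * Δ + 1) (htl : t ≤ l) (htT : t + Δ ≤ T) : Reach D x (p t) := by
  classical
  obtain ⟨X, lX, hX⟩ := hxz.exists_geo
  obtain ⟨P, lP, hP⟩ := (hox.reach.trans hxz).exists_geo
  obtain ⟨Y, lY, hlY, hY⟩ := hox.exists_geo
  obtain ⟨j, hj, htj, hdj⟩ := h.exists_dle_of_side hp hP hr hfar htl htT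
  -- The first vertex of `X` leading to `P` is still near `o`, so it enters `P` at an index at most
  -- `C + 2Δ + 1`, before `P j`.
  have hex : ∃ i, i ≤ lX ∧ ∃ e ≤ lP, Dle D (X i) (P e) Δ :=
    ⟨lX, le_rfl, lP, le_rfl, by rw [hX.last, hP.last]; exact Dle.refl _ _⟩
  obtain ⟨hi, e, he, hde⟩ := Nat.find_spec hex
  have hmin : ∀ k, k < Nat.find hex → ¬ _ := fun k hk => Nat.find_min hex hk
  generalize Nat.find hex = i at hi hde hmin
  have hoX : Dle D o (X i) (C + Δ + 1) := by
    rcases Nat.eq_zero_or_pos i with rfl | hpos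
    · rw [hX.zero]
      exact hox.mono (by omega)
    · rcases h.thin hX (Or.inr hY) (Or.inr hP) (i - 1) (by omega) with ⟨f, hf, hdf⟩ | hcon
      · exact (((hY.dle_left hf).trans hdf).trans
          (hX.dle_apply (Nat.sub_le i 1) hi)).mono (by omega)
      · exact absurd ⟨by omega, hcon⟩ (hmin (i - 1) (by omega))
  have hej := hP.le_of_dle_left he (hoX.trans hde)
  exact (hX.dle_left hi).reach.trans (hde.reach.trans
    ((hP.dle_apply (by omega : e ≤ j) hj).reach.trans hdj.reach))

/-- König's lemma, as compactness of a product of finite discrete balls. -/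
theorem OutFinite.exists_subseq_tendsto (hO : OutFinite D) {o : V} {p : ℕ → ℕ → V}
    (hp : ∀ T t, Dle D o (p T t) t) : ∃ (φ : ℕ → ℕ) (R : ℕ → V), StrictMono φ ∧
      ∀ t, ∀ᶠ i in Filter.atTop, ∀ s ≤ t, p (φ i) s = R s := by
  let _ : TopologicalSpace V := ⊥
  have : DiscreteTopology V := ⟨rfl⟩
  have hcpt : IsCompact (Set.univ.pi fun t => {y | Dle D o y t}) :=
    isCompact_univ_pi fun t => (hO.finite_dle o t).isCompact
  obtain ⟨R, -, φ, hφ, hlim⟩ := hcpt.tendsto_subseq (x := p) fun T t _ => hp T t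
  refine ⟨φ, R, hφ, fun t => ?_⟩
  have h1 : ∀ s ∈ Finset.Iic t, ∀ᶠ i in Filter.atTop, p (φ i) s = R s := fun s _ => by
    have := (tendsto_pi_nhds.1 hlim) s
    rw [nhds_discrete, Filter.tendsto_pure] at this
    exact this
  filter_upwards [(Filter.eventually_all_finset _).2 h1] with i hi s hs
  exact hi s (Finset.mem_Iic.2 hs)

/-- This makes distance from the single root `o` control distance from every base vertex. The
out-ball of `s` is finite; its in-ball is handled by (B2) if `o` reaches `s`, and is unreachable
from `o` otherwise. -/
theorem exists_dle_of_minDist (h : Hyp D Δ g) (hO : OutFinite D) (o s : V) (K : ℕ) :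
    ∃ K', ∀ v, Reach D o v → Dle D s v K ∨ Dle D v s K → Dle D o v K' := by
  obtain ⟨K1, h1⟩ := exists_bound_of_finite (hO.finite_dle s K)
    (P := fun v k => Reach D o v → Dle D o v k) (fun v => by
      by_cases hv : Reach D o v
      · obtain ⟨k, hk⟩ := hv
        exact ⟨k, fun _ => hk⟩
      · exact ⟨0, fun hv' => absurd hv' hv⟩)
    (fun v k k' hk hP hv => (hP hv).mono hk)
  by_cases hs : Reach D o s
  · obtain ⟨e, he⟩ := hs
    refine ⟨max K1 (g (max e K)), fun v hv hd => ?_⟩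
    rcases hd with hd | hd
    · exact (h1 v hd hv).mono (le_max_left _ _)
    · exact (h.b2' he hd hv).mono (le_max_right _ _)
  · refine ⟨K1, fun v hv hd => ?_⟩
    rcases hd with hd | hd
    · exact h1 v hd hv
    · exact absurd (hv.trans hd.reach) hs

theorem LateReach.exists_forall_reach {o : V} {b : ℕ → V} (hb : Rep D b)
    (hlate : LateReach D (fun _ => o) b) : ∃ N, ∀ n, N ≤ n → Reach D o (b n) := by
  obtain ⟨_, j, -, -, hr⟩ := hlate 0
  rcases hb with ⟨x, rfl⟩ | ⟨c, hb⟩ | ⟨c, hb⟩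
  · exact ⟨0, fun _ _ => hr⟩
  · exact ⟨j, fun n hn => hr.trans (hb.reach hn)⟩
  · refine ⟨0, fun n _ => ?_⟩
    obtain ⟨_, i, -, hi, hr'⟩ := hlate n
    exact hr'.trans (hb.reach_of_rev hi)

/-- For all but finitely many members of the sequence, late members of a representing sequence
are joined by geodesics far from `o`. -/
theorem eventually_exists_side (h : Hyp D Δ g) (hO : OutFinite D) (o : V) (T : ℕ)
    {u : ℕ → Bordification D} {a : ℕ → ℕ → V} (ha : ∀ k, a k ∈ reps (u k))
    (hu : ∀ x, ∀ᶠ k in Filter.atTop, u k ≠ Sum.inl x) :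
    ∀ᶠ k in Filter.atTop, ∃ N, ∀ n n', N ≤ n → n ≤ n' → ∃ (p : ℕ → V) (l : ℕ),
      (Geo D p l (a k n) (a k n') ∨ Geo D p l (a k n') (a k n)) ∧
        ∀ j ≤ l, ¬ Dle D o (p j) T := by
  filter_upwards [(Filter.eventually_all_finite (hO.finite_dle o T)).2 fun x _ => hu x] with k hk
  have hak := ha k
  rcases hx : u k with x | η
  · rw [hx] at hak hk
    obtain hak : a k = fun _ => x := hak
    refine ⟨0, fun n n' _ _ => ⟨fun _ => x, 0, Or.inl ?_, fun j _ hd => hk x hd rfl⟩⟩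
    rw [hak]
    exact ⟨⟨rfl, rfl, fun i hi => absurd hi i.not_lt_zero⟩, fun m _ => m.zero_le⟩
  · rw [hx] at hak
    obtain ⟨R, -, hR⟩ := hak
    rw [hR]
    rcases R.exists_qRay with ⟨c, hc⟩ | ⟨c, hc⟩
    · obtain ⟨N, hN⟩ := hc.exists_side h hO o T
      refine ⟨N, fun n n' hn hn' => ?_⟩
      obtain ⟨p, l, hp⟩ := (hc.reach hn').exists_geo
      exact ⟨p, l, Or.inl hp, hN n n' hn hn' p l hp⟩
    · obtain ⟨N, hN⟩ := hc.exists_side_of_rev h hO o T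
      refine ⟨N, fun n n' hn hn' => ?_⟩
      obtain ⟨p, l, hp⟩ := (hc.reach_of_rev hn').exists_geo
      exact ⟨p, l, Or.inr hp, hN n n' hn hn' p l hp⟩

theorem isQuasiGeodRay_of_geo {R : ℕ → V} {o : V} (hR : ∀ m, Geo D R m o (R m)) :
    IsQuasiGeodRay D R := by
  have hle : ∀ {i j m : ℕ}, i ≤ j → Dle D (R i) (R j) m → j ≤ i + m := fun hij hd =>
    (hR _).le_of_dle hij le_rfl hd
  refine ⟨fun i j hij => ?_, fun i => (hR (i + 1)).path.2.2 i (Nat.lt_succ_self i), 1, 0, le_rfl,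
    le_rfl, fun i j hij => ?_⟩
  · rcases le_total i j with h | h
    · have := hle h (by rw [hij]; exact Dle.refl (R j) 0)
      omega
    · have := hle h (by rw [hij]; exact Dle.refl (R j) 0)
      omega
  · rw [ENNReal.ofReal_one, one_mul, ENNReal.ofReal_zero, add_zero]
    refine le_iInf fun p => le_iInf fun n => le_iInf fun hp => ?_
    have := hle hij ⟨p, n, le_rfl, hp⟩
    exact_mod_cast (by omega : j - i ≤ n)

/-- The limit is the class of a geodesic ray from `o` along which geodesics to members of the
sequence agree for longer and longer. -/
theorem exists_tendsto_of_reach (h : Hyp D Δ g) (hO : OutFinite D) {S : Finset V} {ε : ℝ}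
    (hε : 0 < ε) {o : V} {u : ℕ → Bordification D} {a : ℕ → ℕ → V} (ha : ∀ k, a k ∈ reps (u k))
    (hu : ∀ x, ∀ᶠ k in Filter.atTop, u k ≠ Sum.inl x)
    (ho : ∀ k, LateReach D (fun _ => o) (a k))
    (hgood : ∀ k, ∃ N, ∀ n, N ≤ n → ∀ j, k < j → LateReach D (fun _ => a k n) (a j)) :
    ∃ φ : ℕ → ℕ, StrictMono φ ∧ ∃ x,
      Filter.Tendsto (fun i => bdDist D S ε (u (φ i)) x) Filter.atTop (𝓝 0) := by
  have hside : ∀ T : ℕ, ∀ᶠ k in Filter.atTop, ∃ N, (∀ n, N ≤ n → Reach D o (a k n)) ∧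
      (∀ n, N ≤ n → ∀ j, k < j → LateReach D (fun _ => a k n) (a j)) ∧
      ∀ n, N ≤ n → ∃ (p : ℕ → V) (l : ℕ),
        (Geo D p l (a k N) (a k n) ∨ Geo D p l (a k n) (a k N)) ∧
          ∀ j ≤ l, ¬ Dle D o (p j) T := by
    intro T
    filter_upwards [eventually_exists_side h hO o T ha hu] with k hk
    obtain ⟨N1, h1⟩ := hk
    obtain ⟨N2, h2⟩ := (ho k).exists_forall_reach (rep_of_mem_reps (ha k))
    obtain ⟨N3, h3⟩ := hgood k
    exact ⟨max N1 (max N2 N3), fun n hn => h2 n (by omega), fun n hn => h3 n (by omega),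
      fun n hn => h1 _ n (by omega) hn⟩
  obtain ⟨φ₁, hφ₁, hφ₁'⟩ := Filter.extraction_forall_of_eventually hside
  choose N hreach hlate hgeo using hφ₁'
  choose P l hP using fun T => (hreach T (N T) le_rfl).exists_geo
  have hl : ∀ T, T < l T := by
    intro T
    obtain ⟨r, n, hr, hfar⟩ := hgeo T (N T) le_rfl
    have h0 : r 0 = a (φ₁ T) (N T) := by rcases hr with hr | hr <;> exact hr.zero
    by_contra hlt
    refine hfar 0 n.zero_le ?_
    rw [h0]
    exact (hP T).dle.mono (not_lt.1 hlt)
  -- Geodesics are frozen at their ends; as `T < l T`, this does not affect the first `T` vertices.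
  obtain ⟨φ₂, R, hφ₂, hagree⟩ := hO.exists_subseq_tendsto
    (p := fun T t => P T (min t (l T)))
    fun T t => ((hP T).dle_left (min_le_right t (l T))).mono (min_le_left _ _)
  have hag : ∀ t, ∀ᶠ i in Filter.atTop, t ≤ φ₂ i ∧ ∀ s ≤ t, P (φ₂ i) s = R s := by
    intro t
    filter_upwards [hagree t, Filter.eventually_ge_atTop t] with i hi hti
    have h1 : t ≤ φ₂ i := hti.trans hφ₂.le_apply
    refine ⟨h1, fun s hs => ?_⟩
    have := hi s hs
    rwa [min_eq_left (hs.trans (h1.trans (hl _).le))] at this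
  have hRgeo : ∀ m, Geo D R m o (R m) := by
    intro m
    obtain ⟨i, hi, hs⟩ := (hag m).exists
    have := ((hP (φ₂ i)).take (hi.trans (hl _).le)).congr hs
    rwa [hs m le_rfl] at this
  set Q : QGRay D := ⟨R, Or.inl (isQuasiGeodRay_of_geo hRgeo)⟩ with hQ
  refine ⟨φ₁ ∘ φ₂, hφ₁.comp hφ₂, Sum.inr (boundaryPoint Q), ?_⟩
  have hmem : R ∈ reps (Sum.inr (boundaryPoint Q)) := mem_reps_boundaryPoint h Q
  -- A vertex at distance `C` from `o` reaches a later member of the sequence whose geodesic from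
  -- `o` agrees with `R` past index `C + 3Δ + 1`, hence it reaches `R`.
  have hlateR : ∀ i, LateReach D (a (φ₁ (φ₂ i))) R := by
    intro i M
    obtain ⟨C, hC⟩ := hreach (φ₂ i) (max M (N (φ₂ i))) (le_max_right _ _)
    obtain ⟨i', ⟨hi', hs⟩, hii'⟩ := ((hag (C + 3 * Δ + 1 + Δ)).and
      (Filter.eventually_gt_atTop i)).exists
    obtain ⟨_, n', -, hn', hr⟩ := hlate (φ₂ i) (max M (N (φ₂ i))) (le_max_right _ _)
      (φ₁ (φ₂ i')) (hφ₁ (hφ₂ hii')) (N (φ₂ i'))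
    obtain ⟨r, m, hr', hfar⟩ := hgeo (φ₂ i') n' hn'
    have h1 := h.reach_of_agree (hP (φ₂ i')) hC hr hr' hfar rfl
      (by have := hl (φ₂ i'); omega) hi'
    rw [hs _ (Nat.le_add_right _ _)] at h1
    exact ⟨_, max M (C + 3 * Δ + 1), le_max_left _ _, le_max_left _ _, h1.trans
      ((hRgeo _).dle_apply (le_max_right _ _) le_rfl).reach⟩
  have hnear : ∀ K : ℕ, ∀ᶠ i in Filter.atTop, ∃ M, ∀ n m, M ≤ n → M ≤ m →
      ∀ (q : ℕ → V) (lq : ℕ), Geo D q lq (a (φ₁ (φ₂ i)) n) (R m) → ∀ j ≤ lq,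
        Reach D o (q j) ∧ ¬ Dle D o (q j) K := by
    intro K
    obtain ⟨B, hB⟩ : ∃ B, B = K + 2 * Δ + 2 + g (Δ + g (2 * Δ)) := ⟨_, rfl⟩
    filter_upwards [hag (B + Δ)] with i hi
    refine ⟨max B (N (φ₂ i)), fun n m hn hm q lq hq j hj => ?_⟩
    obtain ⟨r, e, hr, hfar⟩ := hgeo (φ₂ i) n (le_of_max_le_right hn)
    have hox := hreach (φ₂ i) n (le_of_max_le_right hn)
    refine ⟨hox.trans (hq.dle_left hj).reach, ?_⟩
    exact h.not_dle_of_agree hRgeo (hP (φ₂ i)) hox hr hfar hq hB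
      (by have := hl (φ₂ i); omega) (fun t ht => hi.2 t (by omega)) hi.1
      (le_of_max_le_left hm) hj
  have hfar : ∀ K : ℕ, ∀ᶠ i in Filter.atTop, ∀ s ∈ S, FarFrom D s K (a (φ₁ (φ₂ i))) R := by
    intro K
    refine (Filter.eventually_all_finset S).2 fun s _ => ?_
    obtain ⟨K', hK'⟩ := exists_dle_of_minDist h hO o s K
    filter_upwards [hnear K'] with i hi
    obtain ⟨M, hM⟩ := hi
    refine ⟨M, fun n m hn hm q lq hq j hj => ?_⟩
    obtain ⟨h1, h2⟩ := hM n m hn hm q lq hq j hj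
    exact ⟨fun hd => h2 (hK' _ h1 (Or.inl hd)), fun hd => h2 (hK' _ h1 (Or.inr hd))⟩
  refine ENNReal.tendsto_nhds_zero.2 fun e he => ?_
  obtain ⟨K, hK⟩ := ((tendsto_ofReal_exp_neg_mul hε).eventually (ge_mem_nhds he)).exists
  filter_upwards [hfar K] with i hi
  exact (bdDist_le_of_farFrom hε (ha _) hmem (hlateR i) hi).trans hK

end Limit

/-! ### Extracting a convergent subsequence -/

section Main

variable {V : Type*} {D : Digraph V} {Δ : ℕ} {g : ℕ → ℕ}

/-- Of two consecutive points of the sequence, either all late vertices of the first reach the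
second, or the distance vanishes in the backward direction. -/
theorem exists_forall_lateReach_or (h : Hyp D Δ g) (hO : OutFinite D) {S : Finset V} {ε : ℝ}
    (hε : 0 < ε) {η μ : Bordification D} {a b : ℕ → V} (ha : a ∈ reps η) (hb : b ∈ reps μ)
    (hab : LateReach D a b) :
    (∃ N, ∀ n, N ≤ n → LateReach D (fun _ => a n) b) ∨ bdDist D S ε μ η = 0 := by
  rcases rep_of_mem_reps ha with ⟨x, rfl⟩ | ⟨c, hc⟩ | ⟨c, hc⟩
  · exact Or.inl ⟨0, fun n _ => hab⟩
  · refine Or.inl ⟨0, fun n _ M => ?_⟩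
    obtain ⟨i, j, hi, hj, hr⟩ := hab (max n M)
    exact ⟨M, j, le_rfl, le_of_max_le_right hj, (hc.reach (le_of_max_le_left hi)).trans hr⟩
  · rcases rep_of_mem_reps hb with ⟨x, rfl⟩ | ⟨c', hc'⟩ | ⟨c', hc'⟩
    · obtain ⟨i, j, -, -, hr⟩ := hab 0
      exact Or.inl ⟨i, fun n hn M => ⟨M, M, le_rfl, le_rfl, (hc.reach_of_rev hn).trans hr⟩⟩
    · obtain ⟨i, j, -, -, hr⟩ := hab 0
      exact Or.inl ⟨i, fun n hn M => ⟨M, max j M, le_rfl, le_max_right _ _,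
        ((hc.reach_of_rev hn).trans hr).trans (hc'.reach (le_max_left _ _))⟩⟩
    · by_cases hv : HasVertexBetween D a b
      · obtain ⟨v, ⟨n0, hn0⟩, hv⟩ := hv
        exact Or.inl ⟨n0, fun n hn M => ⟨M, M, le_rfl, le_rfl,
          ((hc.reach_of_rev hn).trans hn0).trans (hv M)⟩⟩
      · exact Or.inr (bdDist_eq_zero_of_not_hasVertexBetween h hO hε ha hb hc hc' hab hv)

theorem exists_subseq_tendsto_bdDist (h : Hyp D Δ g) (hO : OutFinite D) {S : Finset V}
    (hS : S.Nonempty) {ε : ℝ} (hε : 0 < ε) {u : ℕ → Bordification D}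
    (hu : ∀ i j, i < j → bdDist D S ε (u i) (u j) < ⊤) :
    ∃ φ : ℕ → ℕ, StrictMono φ ∧ ∃ x,
      Filter.Tendsto (fun i => bdDist D S ε (u (φ i)) x) Filter.atTop (𝓝 0) := by
  have hd := bdDist_isPseudoSemimetric D S ε
  by_cases hrep : ∃ x, ∃ᶠ k in Filter.atTop, u k = x
  · obtain ⟨x, hx⟩ := hrep
    obtain ⟨φ, hφ, hφx⟩ := Filter.extraction_of_frequently_atTop hx
    refine ⟨φ, hφ, x, ?_⟩
    simp only [hφx, hd.self]
    exact tendsto_const_nhds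
  push Not at hrep
  choose a ha using fun k => reps_nonempty h (u k)
  have hlate : ∀ i j, i < j → LateReach D (a i) (a j) := fun i j hij =>
    lateReach_of_bdDist_lt_top h hS (hu i j hij) (ha i) (ha j)
  by_cases hgood : ∃ᶠ k in Filter.atTop,
      ∃ N, ∀ n, N ≤ n → LateReach D (fun _ => a k n) (a (k + 1))
  · obtain ⟨ψ, hψ, hgood⟩ := Filter.extraction_of_frequently_atTop hgood
    choose N hN using hgood
    have hall : ∀ k n, N k ≤ n → ∀ j, ψ k < j → LateReach D (fun _ => a (ψ k) n) (a j) := by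
      intro k n hn j hj
      rcases Nat.eq_or_lt_of_le (Nat.succ_le_of_lt hj) with rfl | hlt
      · exact hN k n hn
      · exact (hN k n hn).trans (rep_of_mem_reps (ha _)) (hlate _ _ hlt)
    -- The root is taken from the first selected member and the sequence is shifted by one, so the
    -- root reaches all members that remain.
    obtain ⟨φ, hφ, x, hx⟩ := exists_tendsto_of_reach h hO (S := S) hε
      (o := a (ψ 0) (N 0)) (u := fun k => u (ψ (k + 1))) (a := fun k => a (ψ (k + 1)))
      (fun k => ha _)
      (fun x => ((hψ.comp (strictMono_nat_of_lt_succ fun k =>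
        Nat.lt_succ_self (k + 1))).tendsto_atTop).eventually (hrep (Sum.inl x)))
      (fun k => hall 0 (N 0) le_rfl _ (hψ (Nat.succ_pos k)))
      (fun k => ⟨N (k + 1), fun n hn j hj => hall (k + 1) n hn _ (hψ (Nat.succ_lt_succ hj))⟩)
    exact ⟨fun i => ψ (φ i + 1), fun i j hij => hψ (Nat.succ_lt_succ (hφ hij)), x, hx⟩
  -- All backward steps from `k0` on cost zero, so `u k0` is a limit of the sequence.
  · obtain ⟨k0, hk0⟩ := Filter.eventually_atTop.1 (Filter.not_frequently.1 hgood)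
    refine ⟨id, strictMono_id, u k0, ?_⟩
    simp only [id_eq]
    refine tendsto_const_nhds.congr' ?_
    filter_upwards [Filter.eventually_ge_atTop k0] with k hk
    induction k, hk using Nat.le_induction with
    | base => exact (hd.self _).symm
    | succ k hk ih =>
      refine le_antisymm zero_le ((hd.triangle _ _ (u k)).trans ?_)
      rw [((exists_forall_lateReach_or h hO (S := S) hε (ha k) (ha (k + 1))
        (hlate _ _ (Nat.lt_succ_self k))).resolve_left (hk0 k hk)), zero_add]
      exact ih.ge

end Main

/-! ### Convergence and completeness in pseudo-semimetric spaces -/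

section Convergence

variable {X : Type*} {d : X → X → ℝ≥0∞}

theorem IsPseudoSemimetric.swap (hd : IsPseudoSemimetric d) :
    IsPseudoSemimetric fun x y => d y x where
  self := hd.self
  triangle x y z := (hd.triangle y x z).trans (add_comm _ _).le

/-- Subbasic balls around other centres add no condition: if `d x z < r`, then `d (u i) x + d x z <
r` eventually. -/
theorem IsPseudoSemimetric.bConverges_iff (hd : IsPseudoSemimetric d) {u : ℕ → X} {x : X} :
    BConverges d u x ↔ Filter.Tendsto (fun i => d (u i) x) Filter.atTop (𝓝 0) := by
  unfold BConverges
  rw [TopologicalSpace.tendsto_nhds_generateFrom_iff]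
  constructor
  · intro h
    refine ENNReal.tendsto_nhds_zero.2 fun e he => ?_
    rcases eq_or_ne e ⊤ with rfl | hne
    · exact Filter.Eventually.of_forall fun _ => le_top
    · have := h (openInBall d e.toReal x) ⟨x, e.toReal, ENNReal.toReal_nonneg, rfl⟩ (by
        simpa [openInBall, hd.self, ENNReal.ofReal_toReal hne] using he)
      filter_upwards [this] with i hi
      rw [Set.mem_preimage, openInBall, Set.mem_ofPred_eq, ENNReal.ofReal_toReal hne] at hi
      exact hi.le
  · rintro h _ ⟨z, r, -, rfl⟩ hx
    have h1 := h.add_const (d x z)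
    rw [zero_add] at h1
    filter_upwards [h1.eventually (gt_mem_nhds hx)] with i hi
    exact (hd.triangle (u i) z x).trans_lt hi

theorem IsPseudoSemimetric.fComplete (hd : IsPseudoSemimetric d) (h : SeqFCompact d) :
    FComplete d := by
  intro u hu
  obtain ⟨N, hN⟩ := hu 1 one_pos
  obtain ⟨φ, hφ, x, hx⟩ := h (fun i => u (N + i)) fun i j hij =>
    (hN (N + i) (N + j) (by omega) (by omega)).trans ENNReal.ofReal_lt_top
  rw [hd.bConverges_iff] at hx
  refine ⟨x, hd.bConverges_iff.2 (ENNReal.tendsto_nhds_zero.2 fun e he => ?_)⟩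
  obtain ⟨e', he', hee'⟩ := ENNReal.lt_iff_exists_nnreal_btwn.1 (ENNReal.half_pos he.ne')
  have hpos : 0 < (e' : ℝ) := by exact_mod_cast he'
  obtain ⟨M, hM⟩ := hu e' hpos
  filter_upwards [Filter.eventually_ge_atTop M] with n hn
  obtain ⟨i, hi, hni⟩ := ((ENNReal.tendsto_nhds_zero.1 hx _ (ENNReal.half_pos he.ne')).and
    (Filter.eventually_ge_atTop n)).exists
  have h1 := hM n (N + φ i) hn (hni.trans (hφ.le_apply.trans (Nat.le_add_left _ _)))
  rw [ENNReal.ofReal_coe_nnreal] at h1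
  calc d (u n) x ≤ d (u n) (u (N + φ i)) + d (u (N + φ i)) x := hd.triangle _ _ _
    _ ≤ e / 2 + e / 2 := add_le_add (h1.le.trans hee'.le) hi
    _ = e := ENNReal.add_halves e

end Convergence

/-! ### Reversing all edges -/

section Reverse

variable {V : Type*} {D : Digraph V}

/-- A quasi-geodesic ray or anti-ray as an anti-ray or ray of the reversed digraph. -/
def QGRay.rev (R : QGRay D) : QGRay (rev D) :=
  ⟨R.1, R.2.symm.imp isQuasiGeodRay_rev.2 isQuasiGeodAntiRay_rev.2⟩

theorem RayLE.rev {R₁ R₂ : QGRay D} (h : RayLE R₁ R₂) : RayLE R₂.rev R₁.rev := by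
  obtain ⟨M, hM⟩ := h
  refine ⟨M, fun r x hr => ?_⟩
  obtain ⟨i, j, p, n, hn, hp, hav⟩ := hM r x hr
  refine ⟨j, i, _, n, hn, hp.rev, ?_⟩
  rintro v ⟨k, hk, rfl⟩ hv
  refine hav (p (n - k)) ⟨n - k, Nat.sub_le _ _, rfl⟩ ?_
  simp only [outBall, inBall, dist_rev, Set.mem_union, Set.mem_ofPred_eq] at hv ⊢
  exact hv.symm

theorem RayEquiv.rev {R₁ R₂ : QGRay D} (h : RayEquiv R₁ R₂) : RayEquiv R₁.rev R₂.rev :=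
  ⟨h.2.rev, h.1.rev⟩

/-- A point of the bordification as a point of the bordification of the reversed digraph. -/
def revPoint : Bordification D → Bordification (rev D)
  | Sum.inl x => Sum.inl x
  | Sum.inr η => Sum.inr ⟨{Q | Q.rev ∈ η.1}, by
      obtain ⟨C, R, rfl⟩ := η
      exact ⟨R.rev, Set.ext fun Q => ⟨fun h => RayEquiv.rev h, fun h => RayEquiv.rev h⟩⟩⟩

/-- Reversing twice gives back `D` definitionally, so the statement type-checks. -/
theorem revPoint_revPoint (η : Bordification D) : revPoint (revPoint η) = η := by
  rcases η with x | η <;> rfl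

theorem reps_revPoint (η : Bordification D) : reps (revPoint η) = reps η := by
  rcases η with x | η
  · rfl
  · ext a
    constructor
    · rintro ⟨R, hR, rfl⟩
      exact ⟨R.rev, hR, rfl⟩
    · rintro ⟨R, hR, rfl⟩
      exact ⟨R.rev, hR, rfl⟩

theorem geodLiminf_rev_le (s : V) (a b : ℕ → V) :
    geodLiminf (rev D) s b a ≤ geodLiminf D s a b := by
  refine iSup_mono fun N => le_iInf fun i => le_iInf fun j => le_iInf fun hi => le_iInf fun hj =>
    le_iInf fun p => le_iInf fun n => le_iInf fun hp => ?_
  refine iInf_le_of_le j (iInf_le_of_le i (iInf_le_of_le hj (iInf_le_of_le hi (iInf_le_of_le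
    (fun k => p (n - k)) (iInf_le_of_le n (iInf_le_of_le
      (isGeodesic_iff.2 (isGeodesic_iff.1 hp).rev) ?_))))))
  refine le_iInf fun k => le_iInf fun hk => ?_
  refine (iInf₂_le (n - k) (Nat.sub_le n k : n - k ∈ Set.Iic n)).trans ?_
  have hnk : n - (n - k) = k := Nat.sub_sub_self hk
  simp only [minDist, dist_rev, hnk]
  exact (min_comm _ _).le

theorem geodLiminf_rev (s : V) (a b : ℕ → V) :
    geodLiminf (rev D) s b a = geodLiminf D s a b :=
  le_antisymm (geodLiminf_rev_le s a b) (geodLiminf_rev_le (D := rev D) s b a)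

theorem hasGeodesics_rev (a b : ℕ → V) : HasGeodesics (rev D) b a ↔ HasGeodesics D a b := by
  simp only [hasGeodesics_iff, LateReach, reach_rev]
  exact forall_congr' fun N => ⟨fun ⟨i, j, hi, hj, h⟩ => ⟨j, i, hj, hi, h⟩,
    fun ⟨i, j, hi, hj, h⟩ => ⟨j, i, hj, hi, h⟩⟩

theorem geodExp_rev (ε : ℝ) (s : V) (a b : ℕ → V) :
    geodExp (rev D) ε s b a = geodExp D ε s a b := by
  by_cases h : HasGeodesics D a b
  · rw [geodExp, geodExp, if_pos h, if_pos ((hasGeodesics_rev a b).2 h), geodLiminf_rev]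
  · rw [geodExp, geodExp, if_neg h, if_neg (mt (hasGeodesics_rev a b).1 h)]

theorem rho_revPoint (S : Finset V) (ε : ℝ) (η μ : Bordification D) :
    rho S ε (revPoint μ) (revPoint η) = rho S ε η μ := by
  unfold rho rhoPt
  simp only [reps_revPoint, geodExp_rev]
  refine Finset.sup_congr rfl fun s _ => ?_
  rw [iInf₂_comm]

theorem bdDist_revPoint_le (S : Finset V) (ε : ℝ) (η μ : Bordification D) :
    bdDist (rev D) S ε (revPoint μ) (revPoint η) ≤ bdDist D S ε η μ := by
  refine le_iInf fun n => le_iInf fun c => le_iInf fun h0 => le_iInf fun hn => ?_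
  refine iInf_le_of_le n (iInf_le_of_le (fun i => revPoint (c (n - i))) (iInf_le_of_le
    (by simp [hn]) (iInf_le_of_le (by simp [h0]) ?_)))
  rw [← Finset.sum_range_reflect]
  refine Finset.sum_le_sum fun i hi => ?_
  rw [Finset.mem_range] at hi
  rw [rho_revPoint, show n - (n - 1 - i + 1) = i by omega, show n - (n - 1 - i) = i + 1 by omega]

theorem bdDist_revPoint (S : Finset V) (ε : ℝ) (η μ : Bordification D) :
    bdDist (rev D) S ε (revPoint μ) (revPoint η) = bdDist D S ε η μ := by
  refine le_antisymm (bdDist_revPoint_le S ε η μ) ?_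
  have := bdDist_revPoint_le (D := rev D) S ε (revPoint μ) (revPoint η)
  rwa [revPoint_revPoint, revPoint_revPoint] at this

end Reverse

/-! ### Sequential compactness of the bordification -/

section Compact

variable {V : Type*} {D : Digraph V} {Δ : ℕ} {g : ℕ → ℕ}

theorem seqFCompact_bdDist (h : Hyp D Δ g) (hO : OutFinite D) {S : Finset V}
    (hS : S.Nonempty) {ε : ℝ} (hε : 0 < ε) : SeqFCompact (bdDist D S ε) := by
  intro u hu
  obtain ⟨φ, hφ, x, hx⟩ := exists_subseq_tendsto_bdDist h hO hS hε hu
  exact ⟨φ, hφ, x, (bdDist_isPseudoSemimetric D S ε).bConverges_iff.2 hx⟩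

theorem seqBCompact_bdDist (h : Hyp D Δ g) (hI : InFinite D) {S : Finset V}
    (hS : S.Nonempty) {ε : ℝ} (hε : 0 < ε) : SeqBCompact (bdDist D S ε) := by
  intro u hu
  have hO : OutFinite (rev D) := fun x => by simpa only [dist_rev] using hI x
  obtain ⟨φ, hφ, x, hx⟩ := exists_subseq_tendsto_bdDist h.rev hO hS hε
    (u := fun i => revPoint (u i)) fun i j hij => by
      rw [bdDist_revPoint]
      exact hu i j hij
  obtain ⟨y, rfl⟩ : ∃ y : Bordification D, revPoint y = x :=
    ⟨revPoint (D := rev D) x, revPoint_revPoint x⟩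
  refine ⟨φ, hφ, y, ?_⟩
  simp only [bdDist_revPoint] at hx
  -- f-convergence is by definition b-convergence for the swapped distance.
  exact (bdDist_isPseudoSemimetric D S ε).swap.bConverges_iff.2 hx

/-- For empty `S` the maximum defining `rho` is zero, and finite distance would say nothing about
reachability. -/
theorem IsBase.nonempty_of_bordification {S : Finset V} (hS : IsBase (dist D) (S : Set V))
    (η : Bordification D) : S.Nonempty := by
  have : ∃ _ : V, True := by
    rcases η with x | ⟨C, R, rfl⟩
    · exact ⟨x, trivial⟩
    · exact ⟨R.1 0, trivial⟩
  obtain ⟨x, -⟩ := this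
  obtain ⟨s, hs, -⟩ := hS x
  exact ⟨s, hs⟩

end Compact

end HypDigraph

theorem mainTheorem9 {V : Type*} (D : Digraph V) (δ : ℝ) (hδ : 0 ≤ δ)
    (hD : HypDigraph.IsHyperbolic D δ)
    (f : ℝ → ℝ) (hB1 : HypDigraph.B1 (HypDigraph.dist D) f)
    (hB2 : HypDigraph.B2 (HypDigraph.dist D) f)
    (S : Finset V) (hS : HypDigraph.IsBase (HypDigraph.dist D) (S : Set V))
    (ε : ℝ) (hε : 0 < ε)
    (hsmall : Real.exp (2 * ε * (6 * δ + 2 * δ * f (δ + 1))) < Real.sqrt 2) :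
    (HypDigraph.OutFinite D → HypDigraph.SeqFCompact (HypDigraph.bdDist D S ε)) ∧
    (HypDigraph.InFinite D → HypDigraph.SeqBCompact (HypDigraph.bdDist D S ε)) ∧
    (HypDigraph.OutFinite D → HypDigraph.IsSemimetric (HypDigraph.bdDist D S ε) →
      HypDigraph.FComplete (HypDigraph.bdDist D S ε)) ∧
    (HypDigraph.InFinite D → HypDigraph.IsSemimetric (HypDigraph.bdDist D S ε) →
      HypDigraph.BComplete (HypDigraph.bdDist D S ε)) := by
  obtain ⟨Δ, g, h⟩ := hD.exists_hyp hB1 hB2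
  have hd := HypDigraph.bdDist_isPseudoSemimetric D S ε
  have hF : HypDigraph.OutFinite D → HypDigraph.SeqFCompact (HypDigraph.bdDist D S ε) :=
    fun hO u => HypDigraph.seqFCompact_bdDist h hO (hS.nonempty_of_bordification (u 0)) hε u
  have hB : HypDigraph.InFinite D → HypDigraph.SeqBCompact (HypDigraph.bdDist D S ε) :=
    fun hI u => HypDigraph.seqBCompact_bdDist h hI (hS.nonempty_of_bordification (u 0)) hε u
  exact ⟨hF, hB, fun hO _ => hd.fComplete (hF hO), fun hI _ => hd.swap.fComplete (hB hI)⟩
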